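/- **Setting.** Let $\mathcal X$ (states) and $\mathcal U$ (controls) be Borel spaces, $U:\mathcal X\rightrightarrows\mathcal U$ a measurable multifunction with nonempty values, $Q$ a controlled transition kernel from $\mathrm{graph}(U)$ to $\mathcal X$, $c:\mathcal X\times\mathcal U\times\mathcal X\to\mathbb R$ a cost function, and $x_A\in\mathcal X$ an absorbing state: $Q(\{x_A\}|x_A,u)=1$ and $c(x_A,u,x_A)=0$ for all $u\in U(x_A)$. Put $\widetilde{\mathcal X}=\mathcal X\setminus\{x_A\}$. Let $P_0$ be a probability measure on $\mathcal X$, $p\in[1,\infty)$, $1/p+1/q=1$, $\mathcal V=L_p(\mathcal X,P_0)$, and let $\mathcal M$ be the set of probability measures $m\ll P_0$ with density in $L_q(P_0)$. Let $\sigma:\mathcal V\times\mathcal X\times\mathcal M\to\mathbb R$ be a law invariant risk transition mapping: $\sigma$ is measurable; each $\sigma(\cdot,x,m)$ is convex, monotone, positively homogeneous and satisfies $\sigma(a+\varphi,x,m)=a+\sigma(\varphi,x,m)$ for $a\in\mathbb R$; and $\sigma(\varphi,x,\mu)=\sigma(\psi,x,\nu)$ whenever $\varphi$ under $\mu$ and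 $\psi$ under $\nu$ have the same distribution. Put $\mathcal A(x,m)=\{\mu\in\mathcal M:\ \int\varphi\,d\mu\le\sigma(\varphi,x,m)\ \ \forall\varphi\in\mathcal V\}$, the subdifferential of $\sigma(\cdot,x,m)$ at $0$. Let $w:\mathcal X\to[1,\infty)$ be a measurable weight function with $w\in\mathcal V$, and for $v:\mathcal X\to\mathbb R$ let $\|v\|_w=\sup_{x\in\widetilde{\mathcal X}}|v(x)|/w(x)$. Assume: * (G0) $Q(x,u)\in\mathcal M$ for all $x\in\mathcal X$, $u\in U(x)$; * (G1) $Q$ is setwise continuous: $(x,u)\mapsto Q(B|x,u)$ is continuous on $\mathrm{graph}(U)$ for every Borel set $B$; * (G2) $\mathcal A$ is lower semicontinuous: if $x_k\to x$ in $\mathcal X$, $m_k\to m$ weakly$^*$ in $\mathcal M$ (that is, $\int v\,dm_k\to\int v\,dm$ for all $v\in\mathcal V$) and $\mu\in\mathcal A(x,m)$, then there are $\mu_k\in\mathcal A(x_k,m_k)$ with $\mu_k\to\mu$ weakly$^*$; * (G3) $c$ is measurable, $|c(x,u,y)|\le C(w(x)+w(y))$ for some constant $C$ and all $x\in\mathcal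 X$, $u\in U(x)$, $y\in\mathcal X$, and $c(\cdot,\cdot,y)$ is lower semicontinuous on $\mathrm{graph}(U)$ for every $y$. For a measurable decision rule $\pi:\mathcal X\to\mathcal U$ with $\pi(x)\in U(x)$ for all $x$, and the stationary deterministic Markov policy $\Pi=\{\pi,\pi,\dots\}$, the nested risk measures are given by $J_0(\Pi,\cdot)=0$ and $$J_{T+1}(\Pi,x)=\sigma\big(c(x,\pi(x),\cdot)+J_T(\Pi,\cdot),\,x,\,Q(x,\pi(x))\big),\qquad x\in\mathcal X.$$ Let $\widetilde{\mathfrak M}^\pi(x)$, $x\in\widetilde{\mathcal X}$, be the set of restrictions to $\widetilde{\mathcal X}$ of the measures in $\mathcal A(x,Q(x,\pi(x)))$. A kernel $M$ on $\widetilde{\mathcal X}$ is a selector of a multikernel $\mathfrak M$, written $M\lessdot\mathfrak M$, if $M(x)\in\mathfrak M(x)$ for all $x$. The composition of multikernels is $[\mathfrak M_1\mathfrak M_2](x)=\{[M_1M_2](\cdot|x): M_i\lessdot\mathfrak M_i\}$, where $[M_1M_2](B|x)=\int M_2(B|y)\,M_1(dy|x)$, and sums are Minkowski sums of values. The model is *risk-transient*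 for $\Pi$ (with weight $w$) if there is a constant $K$ such that $$\sup_{x\in\widetilde{\mathcal X}}\frac1{w(x)}\int_{\widetilde{\mathcal X}}w(y)\,M(dy|x)\le K\qquad\text{for all } M\lessdot\sum_{j=1}^T(\widetilde{\mathfrak M}^\pi)^j \text{ and all } T\ge0;$$ it is *uniformly risk-transient* if $K$ can be chosen independently of the decision rule $\pi$. **Theorem.** 1. If the model is risk-transient for $\Pi$, then all $J_T(\Pi,\cdot)$ and all $c(x,\pi(x),\cdot)+J_T(\Pi,\cdot)$ are in $\mathcal V$, and the limit $J_\infty(\Pi,\cdot)=\lim_{T\to\infty}J_T(\Pi,\cdot)$ exists in $\mathcal V$ (in the norm of $\mathcal V$, and pointwise at every $x\in\mathcal X$). It is measurable and $w$-bounded, that is, $\|J_\infty(\Pi,\cdot)\|_w<\infty$, and it vanishes at $x_A$. The convergence is $w$-uniform: $\|J_T(\Pi,\cdot)-J_\infty(\Pi,\cdot)\|_w\to0$. 2. If the model is uniformly risk-transient, then $\|J_\infty(\Pi,\cdot)\|_w$ is bounded uniformly over all stationary deterministic Markov policies $\Pi$. If, moreover, $Q$ is weakly$^*$ continuous, that is,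 $(x,u)\mapsto\int v(y)\,Q(dy|x,u)$ is continuous on $\mathrm{graph}(U)$ for every $v\in\mathcal V$, then $(\pi,x)\mapsto J_\infty(\Pi,x)$ is lower semicontinuous in the following sense, at every decision rule $\pi$ and every state $x$ such that $w$ is bounded on a neighbourhood of $x$ (hence everywhere if $w$ is locally bounded, for example continuous): if $x_k\to x$, $\pi_k(x_k)\to\pi(x)$, and $\pi_k(y)\to\pi(y)$ for $P_0$-almost every $y$, then $$J_\infty(\Pi,x)\le\liminf_{k\to\infty}J_\infty(\Pi_k,x_k),\qquad \Pi_k=\{\pi_k,\pi_k,\dots\}.$$ -/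

import Mathlib

open MeasureTheory ProbabilityTheory Filter Topology
open scoped ENNReal NNReal Pointwise

namespace RiskMDP

noncomputable section

/-! ### Controlled Markov models with an absorbing state -/

/-- A stationary controlled Markov model: a measurable control multifunction `U` with nonempty
values, a controlled transition kernel `Q` on the graph of `U`, a cost function `c`, and an
absorbing state `xA` at which no costs are incurred. -/
structure Model (X 𝒰 : Type*) [TopologicalSpace X] [MeasurableSpace X]
    [TopologicalSpace 𝒰] [MeasurableSpace 𝒰] where
  U : X → Set 𝒰
  U_nonempty : ∀ x, (U x).Nonempty
  U_measurable : ∀ O : Set 𝒰, IsOpen O → MeasurableSet {x | (U x ∩ O).Nonempty}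
  Q : Kernel {z : X × 𝒰 // z.2 ∈ U z.1} X
  Q_markov : IsMarkovKernel Q
  c : X → 𝒰 → X → ℝ
  xA : X
  absorbing : ∀ u (hu : u ∈ U xA), Q ⟨(xA, u), hu⟩ {xA} = 1
  cost_absorbing : ∀ u ∈ U xA, c xA u xA = 0

section Basic

variable {X 𝒰 : Type*} [TopologicalSpace X] [MeasurableSpace X]
  [TopologicalSpace 𝒰] [MeasurableSpace 𝒰]

/-- The graph of the control multifunction. -/
abbrev Model.Graph (S : Model X 𝒰) : Type _ := {z : X × 𝒰 // z.2 ∈ S.U z.1}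

/-- The effective state space: all states other than the absorbing one. -/
abbrev Model.Eff (S : Model X 𝒰) : Type _ := {x : X // x ≠ S.xA}

/-- A deterministic decision rule: a measurable selector of `U`. It is identified with the
stationary deterministic Markov policy that applies it at every time. -/
structure Rule (S : Model X 𝒰) where
  toFun : X → 𝒰
  measurable : Measurable toFun
  feasible : ∀ x, toFun x ∈ S.U x

/-- The point `(x, π x)` of the graph of `U`. -/
def Rule.pt {S : Model X 𝒰} (π : Rule S) (x : X) : S.Graph := ⟨(x, π.toFun x), π.feasible x⟩

end Basic

/-! ### Risk transition mappings -/

section Risk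

variable {X : Type*} [MeasurableSpace X]

/-- The probability measures that belong to the dual of `L_p(P₀)`, that is, that are absolutely
continuous with respect to `P₀` with a density in `L_q(P₀)`. -/
def probDual (P₀ : Measure X) (q : ℝ≥0∞) : Set (Measure X) :=
  {m | IsProbabilityMeasure m ∧ m ≪ P₀ ∧ MemLp (fun y => (m.rnDeriv P₀ y).toReal) q P₀}

variable (p q : ℝ≥0∞) [Fact (1 ≤ p)] (P₀ : Measure X) [IsProbabilityMeasure P₀]

/-- A coherent measure of risk on `L_p(P₀)`. -/
structure IsCoherent (ρ : Lp ℝ p P₀ → ℝ) : Prop where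
  convex : ∀ (a : ℝ) (φ ψ : Lp ℝ p P₀), 0 < a → a < 1 →
    ρ (a • φ + (1 - a) • ψ) ≤ a * ρ φ + (1 - a) * ρ ψ
  mono : ∀ φ ψ : Lp ℝ p P₀, φ ≤ ψ → ρ φ ≤ ρ ψ
  translation : ∀ (a : ℝ) (φ : Lp ℝ p P₀), ρ (Lp.const p P₀ a + φ) = a + ρ φ
  pos_homogeneous : ∀ (b : ℝ) (φ : Lp ℝ p P₀), 0 ≤ b → ρ (b • φ) = b * ρ φ

/-- A risk transition mapping. The set `probDual P₀ q` carries the σ-algebra generated by the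
evaluations on measurable sets, `L_p(P₀)` its Borel σ-algebra. -/
structure RiskTransitionMapping where
  toFun : Lp ℝ p P₀ → X → probDual P₀ q → ℝ
  measurable : Measurable[(borel (Lp ℝ p P₀)).prod
      (inferInstance : MeasurableSpace (X × probDual P₀ q))]
    (fun z : Lp ℝ p P₀ × X × probDual P₀ q => toFun z.1 z.2.1 z.2.2)
  coherent : ∀ x m, IsCoherent p P₀ (fun φ => toFun φ x m)

variable {p q P₀}

/-- Law invariance: the value depends on the function and the measure only through the
distribution of the function under the measure. -/
def RiskTransitionMapping.LawInvariant (σ : RiskTransitionMapping p q P₀) : Prop :=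
  ∀ (φ ψ : Lp ℝ p P₀) (μ ν : probDual P₀ q),
    (∀ η : ℝ, (μ : Measure X) {y | φ y ≤ η} = (ν : Measure X) {y | ψ y ≤ η}) →
      ∀ x, σ.toFun φ x μ = σ.toFun ψ x ν

/-- The subdifferential at `0` of `φ ↦ σ(φ, x, m)`. By monotonicity, the translation property and
`σ(0, x, m) = 0`, all subgradients are probability measures. -/
def RiskTransitionMapping.subdiff (σ : RiskTransitionMapping p q P₀) (x : X)
    (m : probDual P₀ q) : Set (probDual P₀ q) :=
  {μ | ∀ φ : Lp ℝ p P₀, ∫ y, φ y ∂(μ : Measure X) ≤ σ.toFun φ x m}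

/-- Weak* convergence of a sequence in `probDual P₀ q`. -/
def WeakStarTendsto (p : ℝ≥0∞) {q : ℝ≥0∞} {P₀ : Measure X} (ms : ℕ → probDual P₀ q)
    (m : probDual P₀ q) : Prop :=
  ∀ v : X → ℝ, MemLp v p P₀ →
    Tendsto (fun k => ∫ y, v y ∂(ms k : Measure X)) atTop (𝓝 (∫ y, v y ∂(m : Measure X)))

/-- Lower semicontinuity of the multifunction `(x, m) ↦ ∂σ(0, x, m)`, in terms of sequences. -/
def RiskTransitionMapping.SubdiffLSC [TopologicalSpace X]
    (σ : RiskTransitionMapping p q P₀) : Prop :=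
  ∀ (x : X) (m : probDual P₀ q) (xs : ℕ → X) (ms : ℕ → probDual P₀ q),
    Tendsto xs atTop (𝓝 x) → WeakStarTendsto p ms m →
      ∀ μ ∈ σ.subdiff x m, ∃ μs : ℕ → probDual P₀ q,
        (∀ k, μs k ∈ σ.subdiff (xs k) (ms k)) ∧ WeakStarTendsto p μs μ

end Risk

/-! ### Multikernels -/

section Multikernel

variable {E : Type*} [MeasurableSpace E]

/-- `M ⋖ 𝔐`: the kernel `M` is a measurable selector of the multikernel `𝔐`. -/
def IsSelector (M : Kernel E E) (𝔐 : E → Set (Measure E)) : Prop := ∀ x, M x ∈ 𝔐 x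

/-- Composition of multikernels. The kernel `M₂ ∘ₖ M₁` is `B ↦ ∫ M₂(B | y) M₁(dy | x)`. -/
def mkComp (𝔐₁ 𝔐₂ : E → Set (Measure E)) : E → Set (Measure E) := fun x =>
  {μ | ∃ M₁ M₂ : Kernel E E, IsSelector M₁ 𝔐₁ ∧ IsSelector M₂ 𝔐₂ ∧ μ = (M₂ ∘ₖ M₁) x}

/-- Powers of a multikernel. -/
def mkPow (𝔐 : E → Set (Measure E)) : ℕ → E → Set (Measure E)
  | 0 => fun x => {Measure.dirac x}
  | 1 => 𝔐
  | k + 2 => mkComp (mkPow 𝔐 (k + 1)) 𝔐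

/-- The sum of the powers `1, …, T` of a multikernel, with Minkowski addition of values. -/
def mkSum (𝔐 : E → Set (Measure E)) (T : ℕ) : E → Set (Measure E) := fun x =>
  ∑ j ∈ Finset.Icc 1 T, mkPow 𝔐 j x

/-- The operator norm of a kernel associated with a weight function. -/
def opNorm (w : E → ℝ) (A : Kernel E E) : ℝ≥0∞ :=
  ⨆ x, (∫⁻ y, ENNReal.ofReal (w y) ∂(A x)) / ENNReal.ofReal (w x)

/-- The weighted supremum norm of a function. -/
def wNorm (w v : E → ℝ) : ℝ≥0∞ := ⨆ x, ENNReal.ofReal (|v x| / w x)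

end Multikernel

/-! ### Conditions on the model, nested risk and risk-transience -/

section Main

variable {X 𝒰 : Type*} [TopologicalSpace X] [MeasurableSpace X]
  [TopologicalSpace 𝒰] [MeasurableSpace 𝒰]
  {p q : ℝ≥0∞} [Fact (1 ≤ p)] {P₀ : Measure X} [IsProbabilityMeasure P₀]

/-- Every transition probability has a density in `L_q(P₀)`. -/
def Model.InDual (S : Model X 𝒰) (P₀ : Measure X) (q : ℝ≥0∞) : Prop :=
  ∀ z : S.Graph, S.Q z ∈ probDual P₀ q

/-- Setwise continuity of the controlled kernel on the graph of `U`. -/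
def Model.SetwiseContinuous (S : Model X 𝒰) : Prop :=
  ∀ B : Set X, MeasurableSet B → Continuous fun z : S.Graph => S.Q z B

/-- Weak* continuity of the controlled kernel on the graph of `U`. -/
def Model.WeakStarContinuous (S : Model X 𝒰) (p : ℝ≥0∞) (P₀ : Measure X) : Prop :=
  ∀ v : X → ℝ, MemLp v p P₀ → Continuous fun z : S.Graph => ∫ y, v y ∂(S.Q z)

/-- A weight function `w : X → [1, ∞)` in `L_p(P₀)`. -/
structure IsWeight (w : X → ℝ) (p : ℝ≥0∞) (P₀ : Measure X) : Prop where
  measurable : Measurable w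
  one_le : ∀ x, 1 ≤ w x
  memLp : MemLp w p P₀

/-- The cost function is measurable, `w`-bounded, and lower semicontinuous in the state and the
control on the graph of `U`. -/
structure Model.CostRegular (S : Model X 𝒰) (w : X → ℝ) : Prop where
  measurable : Measurable fun z : X × 𝒰 × X => S.c z.1 z.2.1 z.2.2
  bounded : ∃ C > 0, ∀ x, ∀ u ∈ S.U x, ∀ y, |S.c x u y| ≤ C * (w x + w y)
  lsc : ∀ y, LowerSemicontinuous fun z : S.Graph => S.c z.1.1 z.1.2 y

open Classical in
/-- The one-step Markov risk measure under the rule `π`, applied to `g(x, π(x), ·)`: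
`x ↦ σ(g(x, π(x), ·), x, Q(x, π(x)))`. The value is meaningful if `g(x, π(x), ·) ∈ L_p(P₀)`. -/
def oneStepRisk (S : Model X 𝒰) (hQ : S.InDual P₀ q) (σ : RiskTransitionMapping p q P₀)
    (π : Rule S) (g : X → 𝒰 → X → ℝ) (x : X) : ℝ :=
  if h : MemLp (g x (π.toFun x)) p P₀ then
    σ.toFun (h.toLp (g x (π.toFun x))) x ⟨S.Q (π.pt x), hQ (π.pt x)⟩
  else 0

/-- The nested risk `J_T(Π, x) = ρ₁(c(x₁,π(x₁),x₂) + ρ₂(c(x₂,π(x₂),x₃) + ⋯ +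
ρ_T(c(x_T,π(x_T),x_{T+1})) ⋯))`, `x₁ = x`, for the stationary policy `Π = {π, π, …}`. -/
def nestedRisk (S : Model X 𝒰) (hQ : S.InDual P₀ q) (σ : RiskTransitionMapping p q P₀)
    (π : Rule S) : ℕ → X → ℝ
  | 0 => fun _ => 0
  | T + 1 => oneStepRisk S hQ σ π fun x u y => S.c x u y + nestedRisk S hQ σ π T y

/-- The infinite-horizon risk `J_∞(Π, x) = lim_T J_T(Π, x)`. -/
def infiniteRisk (S : Model X 𝒰) (hQ : S.InDual P₀ q) (σ : RiskTransitionMapping p q P₀)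
    (π : Rule S) (x : X) : ℝ :=
  limUnder atTop fun T => nestedRisk S hQ σ π T x

/-- The effective risk multikernel of the rule `π`: the restrictions to the effective state space
of the measures in `𝔐^π(x) = ∂σ(0, x, Q(x, π(x)))`. -/
def effMultikernel (S : Model X 𝒰) (hQ : S.InDual P₀ q) (σ : RiskTransitionMapping p q P₀)
    (π : Rule S) : S.Eff → Set (Measure S.Eff) := fun x =>
  {ν | ∃ μ ∈ σ.subdiff x.1 ⟨S.Q (π.pt x.1), hQ (π.pt x.1)⟩,
    ν = Measure.comap (Subtype.val : S.Eff → X) (μ : Measure X)}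

/-- The estimate that defines risk-transience, with weight `w` and constant `K`. -/
def TransienceEstimate (S : Model X 𝒰) (hQ : S.InDual P₀ q) (σ : RiskTransitionMapping p q P₀)
    (w : X → ℝ) (π : Rule S) (K : ℝ≥0) : Prop :=
  ∀ (T : ℕ) (M : Kernel S.Eff S.Eff),
    IsSelector M (mkSum (effMultikernel S hQ σ π) T) → opNorm (fun x : S.Eff => w x) M ≤ K

/-- The model is risk-transient for the stationary policy `{π, π, …}` with weight `w`. -/
def RiskTransient (S : Model X 𝒰) (hQ : S.InDual P₀ q) (σ : RiskTransitionMapping p q P₀)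
    (w : X → ℝ) (π : Rule S) : Prop :=
  ∃ K : ℝ≥0, TransienceEstimate S hQ σ w π K

/-- The model is uniformly risk-transient with weight `w`. -/
def UniformlyRiskTransient (S : Model X 𝒰) (hQ : S.InDual P₀ q)
    (σ : RiskTransitionMapping p q P₀) (w : X → ℝ) : Prop :=
  ∃ K : ℝ≥0, ∀ π : Rule S, TransienceEstimate S hQ σ w π K

/-- Sequential convergence `(πₖ, xₖ) → (π, x)` of pairs of a rule and a state: `xₖ → x`,
`πₖ(xₖ) → π(x)`, and `πₖ → π` almost everywhere. -/
structure PairTendsto {S : Model X 𝒰} (P₀ : Measure X) (πs : ℕ → Rule S) (xs : ℕ → X)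
    (π : Rule S) (x : X) : Prop where
  state : Tendsto xs atTop (𝓝 x)
  control : Tendsto (fun k => (πs k).toFun (xs k)) atTop (𝓝 (π.toFun x))
  rule : ∀ᵐ y ∂P₀, Tendsto (fun k => (πs k).toFun y) atTop (𝓝 (π.toFun y))

end Main

end

end RiskMDP

open RiskMDP

/-! The risk `σ(·, x, m)` is the maximum of `∫ φ dμ` over `𝒜(x, m)`, and a maximizing measure can be
chosen measurably in the state. Hence the difference of two one-step risks with the same cost is at
most `σ(|v - v'|, x, Q)`, which equals `∫ |v - v'| dM(x)` for a kernel `M` selected from the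
subdifferentials. Values at the absorbing state are zero (by law invariance the risk there is the
value of the argument), so `M` may be cut down to the effective states, where it is a selector of
the multikernel in the definition of transience.

Iteration bounds `|J_T|` by a constant times the sum of `∫ w` over the prefixes of a product of
selectors, and `|J_{T+n} - J_T|` by a product of `T` selectors applied to `|J_n|`. Transience bounds
the prefix sums by `K w`. It also makes products decay: cut after `j` factors, the tail of a product
costs at most `1 + K`, so summation over `j` shows that a product of `T` selectors maps `w` below
`(1 + K) K w / T`. The nested risks are thus Cauchy with `w`-uniform rate `O(1/T)`, with constants
that depend on the rule only through `K` (`abs_nestedRisk_le`, `mul_abs_nestedRisk_sub_le`).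

The measurable maximizers come from a constructive Hahn–Banach argument
(`exists_measurable_clm_le`): repeated directional derivatives along a dense sequence make a
sublinear function linear through countably many infima. Positive normalized functionals on `L_p`,
`p < ∞`, are then represented by measures in `probDual`.

For lower semicontinuity, each `J_T` is treated by induction. A maximizer `μ` at the limit point is
approximated by subgradients `μ_k` of the perturbed problems, and a Fatou lemma for weak* convergent
measures gives `∫ g dμ ≤ liminf ∫ g_k dμ_k`. The uniform rate carries this over to `J_∞` where `w`
is locally bounded. -/

set_option linter.unusedSectionVars false

/-! ### Measurable Hahn–Banach theorem by iterated directional derivatives. -/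

section NatSublinear

open MeasureTheory Filter Topology

/-- A real function on an abelian group that is subadditive and homogeneous with respect to
natural multiples. -/
structure NatSublinear {E : Type*} [AddCommGroup E] (ρ : E → ℝ) : Prop where
  add_le : ∀ φ ψ, ρ (φ + ψ) ≤ ρ φ + ρ ψ
  nsmul : ∀ (n : ℕ) φ, ρ (n • φ) = n * ρ φ

/-- The one-sided directional derivative at `θ` of a sublinear function. -/
noncomputable def directional {E : Type*} [AddCommGroup E] (ρ : E → ℝ) (θ φ : E) : ℝ :=
  ⨅ n : ℕ, (ρ (n • θ + φ) - ρ (n • θ))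

/-- Iterated directional derivatives along a sequence. -/
noncomputable def iterDirectional {E : Type*} [AddCommGroup E] (ρ : E → ℝ) (θ : ℕ → E) :
    ℕ → E → ℝ
  | 0 => ρ
  | k + 1 => directional (iterDirectional ρ θ k) (θ k)

namespace NatSublinear

variable {E : Type*} [AddCommGroup E] {ρ : E → ℝ}

theorem map_zero (h : NatSublinear ρ) : ρ 0 = 0 := by
  simpa using h.nsmul 0 0

theorem neg_le (h : NatSublinear ρ) (φ : E) : -ρ (-φ) ≤ ρ φ := by
  have := h.add_le φ (-φ)
  rw [add_neg_cancel, h.map_zero] at this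
  linarith

/-- Bounds the differences below, so that the real infimum in `directional` is a genuine one and not
a default value. -/
theorem neg_le_sub (h : NatSublinear ρ) (θ φ : E) (n : ℕ) :
    -ρ (-φ) ≤ ρ (n • θ + φ) - ρ (n • θ) := by
  have := h.add_le (n • θ + φ) (-φ)
  rw [add_neg_cancel_right] at this
  linarith

/-- One more `θ` adds at most `ρ θ` to the first term and exactly `ρ θ` to the second. -/
theorem antitone_sub (h : NatSublinear ρ) (θ φ : E) :
    Antitone fun n : ℕ => ρ (n • θ + φ) - ρ (n • θ) := by
  refine antitone_nat_of_succ_le fun n => ?_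
  have h1 := h.add_le (n • θ + φ) θ
  have h2 : (n + 1) • θ + φ = n • θ + φ + θ := by rw [add_smul, one_smul]; abel
  rw [← h2] at h1
  have h3 := h.nsmul (n + 1) θ
  have h4 := h.nsmul n θ
  push_cast at h3
  linarith

theorem tendsto_directional (h : NatSublinear ρ) (θ φ : E) :
    Tendsto (fun n : ℕ => ρ (n • θ + φ) - ρ (n • θ)) atTop (𝓝 (directional ρ θ φ)) :=
  tendsto_atTop_ciInf (h.antitone_sub θ φ) ⟨-ρ (-φ), by
    rintro _ ⟨n, rfl⟩; exact h.neg_le_sub θ φ n⟩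

theorem directional_le (h : NatSublinear ρ) (θ φ : E) : directional ρ θ φ ≤ ρ φ := by
  refine le_of_tendsto' (h.tendsto_directional θ φ) fun n => ?_
  have := h.add_le (n • θ) φ
  linarith

protected theorem directional (h : NatSublinear ρ) (θ : E) : NatSublinear (directional ρ θ) where
  add_le φ ψ := by
    -- Along even indices, `2nθ + φ + ψ` splits into `(nθ + φ) + (nθ + ψ)`.
    have h2 : Tendsto (fun n : ℕ => 2 * n) atTop atTop :=
      tendsto_id.const_mul_atTop' (by norm_num)
    refine le_of_tendsto_of_tendsto' ((h.tendsto_directional θ (φ + ψ)).comp h2)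
      ((h.tendsto_directional θ φ).add (h.tendsto_directional θ ψ)) fun n => ?_
    have h1 := h.add_le (n • θ + φ) (n • θ + ψ)
    have h3 := h.nsmul (2 * n) θ
    have h4 := h.nsmul n θ
    have h5 : (2 * n) • θ + (φ + ψ) = n • θ + φ + (n • θ + ψ) := by
      rw [two_mul, add_smul]; abel
    simp only [Function.comp_apply]
    rw [h5]
    push_cast at h3
    linarith
  nsmul m φ := by
    rcases Nat.eq_zero_or_pos m with rfl | hm
    · simp [directional]
    have h2 : Tendsto (fun n : ℕ => m * n) atTop atTop :=
      tendsto_id.const_mul_atTop' hm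
    refine tendsto_nhds_unique ((h.tendsto_directional θ (m • φ)).comp h2) ?_
    refine ((h.tendsto_directional θ φ).const_mul (m : ℝ)).congr fun n => ?_
    simp only [Function.comp_apply]
    rw [mul_smul, ← smul_add, h.nsmul m, h.nsmul m]
    ring

/-- The difference is exactly `-ρ θ` once `n ≥ 1`. Differentiation along `θ` therefore makes the
function odd at `θ`, and further derivatives preserve this because they only decrease it. -/
theorem directional_neg_self (h : NatSublinear ρ) (θ : E) : directional ρ θ (-θ) ≤ -ρ θ := by
  refine le_of_tendsto (h.tendsto_directional θ (-θ)) ?_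
  filter_upwards [eventually_ge_atTop 1] with n hn
  obtain ⟨m, rfl⟩ := Nat.exists_eq_add_of_le' hn
  have h1 : (m + 1) • θ + -θ = m • θ := by rw [add_smul, one_smul]; abel
  have h2 := h.nsmul (m + 1) θ
  have h3 := h.nsmul m θ
  rw [h1]
  push_cast at h2
  linarith

theorem iterDirectional (h : NatSublinear ρ) (θ : ℕ → E) (k : ℕ) :
    NatSublinear (iterDirectional ρ θ k) := by
  induction k with
  | zero => exact h
  | succ k ih => exact ih.directional (θ k)

theorem antitone_iterDirectional (h : NatSublinear ρ) (θ : ℕ → E) (φ : E) :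
    Antitone fun k => _root_.iterDirectional ρ θ k φ :=
  antitone_nat_of_succ_le fun k => (h.iterDirectional θ k).directional_le (θ k) φ

theorem iterDirectional_le (h : NatSublinear ρ) (θ : ℕ → E) (k : ℕ) (φ : E) :
    _root_.iterDirectional ρ θ k φ ≤ ρ φ :=
  h.antitone_iterDirectional θ φ (Nat.zero_le k)

theorem tendsto_iterDirectional (h : NatSublinear ρ) (θ : ℕ → E) (φ : E) :
    Tendsto (fun k => _root_.iterDirectional ρ θ k φ) atTop
      (𝓝 (⨅ k, _root_.iterDirectional ρ θ k φ)) :=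
  tendsto_atTop_ciInf (h.antitone_iterDirectional θ φ) ⟨-ρ (-φ), by
    rintro _ ⟨k, rfl⟩
    have h1 := (h.iterDirectional θ k).neg_le φ
    have h2 := h.iterDirectional_le θ k (-φ)
    simp only
    linarith⟩

theorem iInf_iterDirectional (h : NatSublinear ρ) (θ : ℕ → E) :
    NatSublinear fun φ => ⨅ k, _root_.iterDirectional ρ θ k φ where
  add_le φ ψ := le_of_tendsto_of_tendsto' (h.tendsto_iterDirectional θ _)
    ((h.tendsto_iterDirectional θ φ).add (h.tendsto_iterDirectional θ ψ))
    fun k => (h.iterDirectional θ k).add_le φ ψ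
  nsmul m φ := tendsto_nhds_unique (h.tendsto_iterDirectional θ _)
    (((h.tendsto_iterDirectional θ φ).const_mul (m : ℝ)).congr fun k =>
      ((h.iterDirectional θ k).nsmul m φ).symm)

theorem iInf_iterDirectional_le (h : NatSublinear ρ) (θ : ℕ → E) (k : ℕ) (φ : E) :
    ⨅ k, _root_.iterDirectional ρ θ k φ ≤ _root_.iterDirectional ρ θ k φ :=
  le_of_tendsto (h.tendsto_iterDirectional θ φ)
    ((eventually_ge_atTop k).mono fun _ hm => h.antitone_iterDirectional θ φ hm)

theorem iInf_iterDirectional_neg_le (h : NatSublinear ρ) (θ : ℕ → E) (k : ℕ) :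
    ⨅ j, _root_.iterDirectional ρ θ j (-θ k) ≤ -_root_.iterDirectional ρ θ k (θ k) :=
  (h.iInf_iterDirectional_le θ (k + 1) _).trans
    ((h.iterDirectional θ k).directional_neg_self (θ k))

theorem iInf_iterDirectional_neg (h : NatSublinear ρ) (θ : ℕ → E) (k : ℕ) :
    ⨅ j, _root_.iterDirectional ρ θ j (-θ k) = -⨅ j, _root_.iterDirectional ρ θ j (θ k) := by
  have h1 := h.iInf_iterDirectional_neg_le θ k
  have h2 := h.iInf_iterDirectional_le θ k (θ k)
  have h3 := (h.iInf_iterDirectional θ).neg_le (θ k)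
  linarith

/-- Only the first direction keeps its original value: oddness there turns the upper bound `-ρ (θ
0)` at `-θ 0` into a lower bound at `θ 0`. -/
theorem iInf_iterDirectional_zero (h : NatSublinear ρ) (θ : ℕ → E) :
    ⨅ j, _root_.iterDirectional ρ θ j (θ 0) = ρ (θ 0) := by
  have h1 := h.iInf_iterDirectional_neg_le θ 0
  have h2 := h.iInf_iterDirectional_neg θ 0
  have h3 := h.iInf_iterDirectional_le θ 0 (θ 0)
  simp only [_root_.iterDirectional] at *
  linarith

end NatSublinear

/-- A bounded sublinear function that is odd on a dense set is a continuous linear functional. -/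
theorem NatSublinear.exists_clm {E : Type*} [NormedAddCommGroup E] [NormedSpace ℝ E]
    {ρ : E → ℝ} (h : NatSublinear ρ) {C : ℝ} (hC : ∀ φ, ρ φ ≤ C * ‖φ‖) {D : Set E}
    (hD : Dense D) (hodd : ∀ φ ∈ D, ρ (-φ) = -ρ φ) : ∃ f : E →L[ℝ] ℝ, ∀ φ, f φ = ρ φ := by
  have hlip : ∀ φ ψ, ρ φ - ρ ψ ≤ C * ‖φ - ψ‖ := fun φ ψ => by
    have h1 := h.add_le (φ - ψ) ψ
    rw [sub_add_cancel] at h1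
    linarith [hC (φ - ψ)]
  have hcont : Continuous ρ := by
    have : LipschitzWith (Real.toNNReal C) ρ := by
      refine LipschitzWith.of_le_add_mul _ fun φ ψ => ?_
      rw [dist_eq_norm]
      have h1 := hlip φ ψ
      have h2 : C * ‖φ - ψ‖ ≤ Real.toNNReal C * ‖φ - ψ‖ :=
        mul_le_mul_of_nonneg_right (Real.le_coe_toNNReal C) (norm_nonneg _)
      linarith
    exact this.continuous
  have hodd' : ∀ φ, ρ (-φ) = -ρ φ := fun φ =>
    congrFun (Continuous.ext_on hD (hcont.comp continuous_neg) hcont.neg hodd) φ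
  have hadd : ∀ φ ψ, ρ (φ + ψ) = ρ φ + ρ ψ := fun φ ψ => by
    refine le_antisymm (h.add_le φ ψ) ?_
    have h1 := h.add_le (-φ) (-ψ)
    rw [← neg_add, hodd', hodd', hodd'] at h1
    linarith
  -- Continuity upgrades additivity to real linearity, so homogeneity in natural multiples suffices
  -- throughout.
  exact ⟨(AddMonoidHom.mk' ρ hadd).toRealLinearMap hcont, fun φ => rfl⟩

/-- Measurable Hahn–Banach theorem: a measurable family of bounded sublinear functions on a
separable normed space has a weakly measurable family of subgradients at `0` which attain the
sublinear functions at given measurable arguments. -/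
theorem exists_measurable_clm_le {Ω E : Type*} [MeasurableSpace Ω] [NormedAddCommGroup E]
    [NormedSpace ℝ E] [SecondCountableTopology E] [MeasurableSpace E] [BorelSpace E]
    {ρ : Ω → E → ℝ} (hρ : ∀ ω, NatSublinear (ρ ω)) (hb : ∀ ω, ∃ C, ∀ φ, ρ ω φ ≤ C * ‖φ‖)
    (hm : Measurable (Function.uncurry ρ)) {ψ : Ω → E} (hψ : Measurable ψ) :
    ∃ f : Ω → E →L[ℝ] ℝ, (∀ φ, Measurable fun ω => f ω φ) ∧ (∀ ω φ, f ω φ ≤ ρ ω φ) ∧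
      ∀ ω, f ω (ψ ω) = ρ ω (ψ ω) := by
  -- The argument `ψ ω` comes first, so that the value there is attained; the dense sequence after
  -- it forces linearity.
  set θ : Ω → ℕ → E := fun ω k => Nat.casesOn k (ψ ω) (TopologicalSpace.denseSeq E) with hθ
  have hθm : ∀ k, Measurable fun ω => θ ω k := by
    rintro (_ | k)
    · exact hψ
    · exact measurable_const
  have hk : ∀ (k : ℕ) (φ : Ω → E), Measurable φ →
      Measurable fun ω => iterDirectional (ρ ω) (θ ω) k (φ ω) := by
    intro k
    induction k with
    | zero => exact fun φ hφ => hm.comp (measurable_id.prodMk hφ)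
    | succ k ih =>
      intro φ hφ
      simp only [iterDirectional, directional]
      exact Measurable.iInf fun n => (ih _ (((hθm k).const_smul n).add hφ)).sub
        (ih _ ((hθm k).const_smul n))
  have hex : ∀ ω, ∃ f : E →L[ℝ] ℝ, ∀ φ, f φ = ⨅ k, iterDirectional (ρ ω) (θ ω) k φ := by
    intro ω
    obtain ⟨C, hC⟩ := hb ω
    refine ((hρ ω).iInf_iterDirectional (θ ω)).exists_clm (C := C)
      (fun φ => ((hρ ω).iInf_iterDirectional_le (θ ω) 0 φ).trans (hC φ))
      (TopologicalSpace.denseRange_denseSeq E) ?_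
    rintro _ ⟨k, rfl⟩
    exact (hρ ω).iInf_iterDirectional_neg (θ ω) (k + 1)
  choose f hf using hex
  refine ⟨f, fun φ => ?_, fun ω φ => ?_, fun ω => ?_⟩
  · simp only [hf]
    exact Measurable.iInf fun k => hk k _ measurable_const
  · rw [hf]
    exact (hρ ω).iInf_iterDirectional_le (θ ω) 0 φ
  · rw [hf]
    exact (hρ ω).iInf_iterDirectional_zero (θ ω)

end NatSublinear

/-! ### Positive functionals on `L_p` as measures with density in `L_q`. -/

section LpDual

open MeasureTheory Filter Topology
open scoped ENNReal NNReal

/-- A monotone sublinear function on a Banach lattice is bounded on the unit ball. -/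
theorem exists_bound_of_monotone_sublinear {E : Type*} [NormedAddCommGroup E] [NormedSpace ℝ E]
    [CompleteSpace E] [Lattice E] [IsOrderedAddMonoid E] [OrderClosedTopology E] [HasSolidNorm E]
    {ρ : E → ℝ} (hmono : Monotone ρ) (hhom : ∀ (b : ℝ) φ, 0 ≤ b → ρ (b • φ) = b * ρ φ) :
    ∃ C, ∀ φ, ρ φ ≤ C * ‖φ‖ := by
  by_contra! hcon
  choose φ hφ using fun n : ℕ => hcon ((4 : ℝ) ^ n)
  have hφ0 : ∀ n, 0 < ‖φ n‖ := fun n => by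
    rw [norm_pos_iff]
    intro h0
    have h1 := hφ n
    have h2 := hhom 0 (φ n) le_rfl
    rw [h0] at h1 h2
    simp at h1 h2
    linarith
  -- Scaled to norm `2⁻ⁿ`, the vector `φ n` still has `ρ` above `2ⁿ`. The sum of the absolute values
  -- converges and dominates every term, so by monotonicity its `ρ` would exceed all `2ⁿ`.
  set b : ℕ → ℝ := fun n => ((2 : ℝ) ^ n * ‖φ n‖)⁻¹ with hbdef
  have hb : ∀ n, 0 < b n := fun n => by have := hφ0 n; positivity
  set ψ : ℕ → E := fun n => |b n • φ n| with hψdef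
  have hnorm : ∀ n, ‖ψ n‖ = (1 / 2 : ℝ) ^ n := fun n => by
    have := hφ0 n
    rw [hψdef]
    simp only [norm_abs_eq_norm, norm_smul, Real.norm_eq_abs, abs_of_pos (hb n)]
    simp only [hbdef]
    field_simp
    rw [← mul_pow]
    norm_num
  have hsum : Summable ψ := by
    refine Summable.of_norm ?_
    simp only [hnorm]
    exact summable_geometric_two
  have hlarge : ∀ n, (2 : ℝ) ^ n ≤ ρ (∑' k, ψ k) := fun n => by
    have h1 : ρ (b n • φ n) ≤ ρ (∑' k, ψ k) :=
      hmono ((le_abs_self _).trans (hsum.le_tsum n fun j _ => abs_nonneg _))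
    rw [hhom _ _ (hb n).le] at h1
    refine le_trans ?_ h1
    have h2 := mul_le_mul_of_nonneg_left (hφ n).le (hb n).le
    refine le_trans (le_of_eq ?_) h2
    have := hφ0 n
    simp only [hbdef]
    field_simp
    rw [← pow_mul, mul_comm n 2, pow_mul]
    norm_num
  obtain ⟨n, hn⟩ := pow_unbounded_of_one_lt (ρ (∑' k, ψ k)) (one_lt_two : (1 : ℝ) < 2)
  exact absurd (hlarge n) (not_le.2 hn)

variable {X : Type*} [MeasurableSpace X] {p q : ℝ≥0∞} [Fact (1 ≤ p)] {P₀ : Measure X}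
  [IsProbabilityMeasure P₀]

theorem indicatorConstLp_one_nonneg {B : Set X} (hB : MeasurableSet B) :
    0 ≤ indicatorConstLp p hB (measure_ne_top P₀ B) (1 : ℝ) := by
  rw [← Lp.coeFn_nonneg]
  filter_upwards [indicatorConstLp_coeFn (p := p) (hs := hB) (hμs := measure_ne_top P₀ B)
    (c := (1 : ℝ))] with x hx
  rw [hx]
  exact Set.indicator_nonneg (fun _ _ => zero_le_one) x

theorem sum_indicatorConstLp {A : ℕ → Set X} (hA : ∀ i, MeasurableSet (A i))
    (hd : Pairwise (Function.onFun Disjoint A)) (n : ℕ) :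
    ∑ i ∈ Finset.range n, indicatorConstLp p (hA i) (measure_ne_top P₀ (A i)) (1 : ℝ) =
      indicatorConstLp p (MeasurableSet.biUnion (Set.to_countable {i | i < n}) fun i _ => hA i)
        (measure_ne_top P₀ (⋃ i ∈ {i | i < n}, A i)) (1 : ℝ) := by
  induction n with
  | zero => simp
  | succ n ih =>
    rw [Finset.sum_range_succ, ih, ← indicatorConstLp_disjoint_union]
    · congr 1
      ext x
      simp only [Set.mem_union, Set.mem_iUnion, Set.mem_ofPred_eq, Nat.lt_succ_iff_lt_or_eq]
      constructor
      · rintro (⟨i, hi, hx⟩ | hx)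
        exacts [⟨i, Or.inl hi, hx⟩, ⟨n, Or.inr rfl, hx⟩]
      · rintro ⟨i, hi | rfl, hx⟩
        exacts [Or.inl ⟨i, hi, hx⟩, Or.inr hx]
    · simp only [Set.disjoint_iUnion_left, Set.mem_ofPred_eq]
      exact fun i hi => hd hi.ne

/-- Countable additivity of the future measure: for `p < ∞` the indicators of the finite unions
converge in `L_p`, and `f` is continuous. -/
theorem hasSum_indicatorConstLp (hp : p ≠ ∞) (f : Lp ℝ p P₀ →L[ℝ] ℝ) (hf : ∀ φ, 0 ≤ φ → 0 ≤ f φ)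
    {A : ℕ → Set X} (hA : ∀ i, MeasurableSet (A i)) (hd : Pairwise (Function.onFun Disjoint A)) :
    HasSum (fun i => f (indicatorConstLp p (hA i) (measure_ne_top P₀ (A i)) (1 : ℝ)))
      (f (indicatorConstLp p (MeasurableSet.iUnion hA) (measure_ne_top P₀ _) (1 : ℝ))) := by
  rw [hasSum_iff_tendsto_nat_of_nonneg fun i => hf _ (indicatorConstLp_one_nonneg (hA i))]
  simp only [← map_sum, sum_indicatorConstLp hA hd]
  refine (f.continuous.tendsto _).comp (tendsto_indicatorConstLp_set hp ?_)
  have hsub : ∀ n : ℕ, (⋃ i ∈ {i | i < n}, A i) ⊆ ⋃ i, A i := fun n =>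
    Set.iUnion₂_subset fun i _ => Set.subset_iUnion A i
  have hmon : Monotone fun n : ℕ => ⋃ i ∈ {i | i < n}, A i := fun m n hmn =>
    Set.biUnion_subset_biUnion_left fun i (hi : i < m) => lt_of_lt_of_le hi hmn
  have hU : (⋃ n : ℕ, ⋃ i ∈ {i | i < n}, A i) = ⋃ i, A i := by
    refine Set.Subset.antisymm (Set.iUnion_subset hsub) (Set.iUnion_subset fun i => ?_)
    exact Set.subset_iUnion_of_subset (i + 1)
      (Set.subset_biUnion_of_mem (show i ∈ {j | j < i + 1} from Nat.lt_succ_self i))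
  have h1 := tendsto_measure_iUnion_atTop (μ := P₀) hmon
  rw [hU] at h1
  have h2 := ENNReal.Tendsto.sub (tendsto_const_nhds (x := P₀ (⋃ i, A i))) h1
    (Or.inl (measure_ne_top _ _))
  rw [tsub_self] at h2
  refine h2.congr fun n => ?_
  have hmeas : MeasurableSet (⋃ i ∈ {i | i < n}, A i) :=
    MeasurableSet.biUnion (Set.to_countable _) fun i _ => hA i
  rw [Set.symmDiff_def, Set.sdiff_eq_empty.2 (hsub n), Set.empty_union,
    measure_sdiff (hsub n) hmeas.nullMeasurableSet (measure_ne_top _ _)]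
  rfl

/-- The measure that represents a positive functional on `L_p`. -/
noncomputable def posMeasure (hp : p ≠ ∞) (f : Lp ℝ p P₀ →L[ℝ] ℝ) (hf : ∀ φ, 0 ≤ φ → 0 ≤ f φ) :
    Measure X :=
  Measure.ofMeasurable
    (fun _ hB => ENNReal.ofReal (f (indicatorConstLp p hB (measure_ne_top P₀ _) (1 : ℝ))))
    (by simp)
    (fun A hA hd => by
      have h := hasSum_indicatorConstLp hp f hf hA hd
      rw [← h.tsum_eq, ENNReal.ofReal_tsum_of_nonneg
        (fun i => hf _ (indicatorConstLp_one_nonneg (hA i))) h.summable])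

variable (hp : p ≠ ∞) {f : Lp ℝ p P₀ →L[ℝ] ℝ} (hf : ∀ φ, 0 ≤ φ → 0 ≤ f φ)

theorem posMeasure_apply {B : Set X} (hB : MeasurableSet B) :
    posMeasure hp f hf B =
      ENNReal.ofReal (f (indicatorConstLp p hB (measure_ne_top P₀ B) (1 : ℝ))) :=
  Measure.ofMeasurable_apply B hB

theorem posMeasure_absolutelyContinuous : posMeasure hp f hf ≪ P₀ := by
  refine Measure.AbsolutelyContinuous.mk fun B hB h0 => ?_
  have : indicatorConstLp p hB (measure_ne_top P₀ B) (1 : ℝ) = 0 := by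
    rw [← norm_eq_zero, norm_indicatorConstLp (zero_lt_one.trans_le Fact.out).ne' hp,
      Measure.real, h0]
    have h1 : 0 < p.toReal := ENNReal.toReal_pos (zero_lt_one.trans_le Fact.out).ne' hp
    simp [Real.zero_rpow, h1.ne']
  rw [posMeasure_apply hp hf hB, this]
  simp

theorem isProbabilityMeasure_posMeasure (h1 : f (Lp.const p P₀ 1) = 1) :
    IsProbabilityMeasure (posMeasure hp f hf) :=
  ⟨by rw [posMeasure_apply hp hf MeasurableSet.univ, indicatorConstLp_univ, h1]; simp⟩

theorem lintegral_posMeasure_simpleFunc (g : SimpleFunc X ℝ≥0) :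
    ∃ h : MemLp (fun x => (g x : ℝ)) p P₀,
      ∫⁻ x, g x ∂(posMeasure hp f hf) = ENNReal.ofReal (f h.toLp) := by
  induction g using SimpleFunc.induction with
  | const c hs =>
    rename_i s
    have heq : (fun x => ((SimpleFunc.piecewise s hs (SimpleFunc.const X c)
        (SimpleFunc.const X 0) x : ℝ≥0) : ℝ)) = (c : ℝ) • s.indicator fun _ => (1 : ℝ) := by
      ext x
      by_cases hx : x ∈ s <;> simp [SimpleFunc.coe_piecewise, hx]
    have hm := (memLp_indicator_const p hs (1 : ℝ) (Or.inr (measure_ne_top P₀ s)))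
    refine ⟨heq ▸ hm.const_smul (c : ℝ), ?_⟩
    have h2 : MemLp.toLp _ (heq ▸ hm.const_smul (c : ℝ)) =
        (c : ℝ) • indicatorConstLp p hs (measure_ne_top P₀ s) (1 : ℝ) := by
      rw [indicatorConstLp, ← MemLp.toLp_const_smul]
      exact MemLp.toLp_congr _ _ (Eventually.of_forall fun x => congrFun heq x)
    rw [h2, map_smul, smul_eq_mul, ENNReal.ofReal_mul c.coe_nonneg, ← posMeasure_apply hp hf hs]
    have h3 : ∀ x, (((SimpleFunc.piecewise s hs (SimpleFunc.const X c)
        (SimpleFunc.const X 0)) x : ℝ≥0) : ℝ≥0∞) = s.indicator (fun _ => (c : ℝ≥0∞)) x := by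
      intro x
      by_cases hx : x ∈ s <;> simp [SimpleFunc.coe_piecewise, hx]
    simp only [h3]
    rw [lintegral_indicator_const hs]
    simp
  | add hd hg hg' =>
    rename_i g g'
    obtain ⟨hm, he⟩ := hg
    obtain ⟨hm', he'⟩ := hg'
    have heq : (fun x => (((g + g') x : ℝ≥0) : ℝ)) = (fun x => (g x : ℝ)) + fun x => (g' x : ℝ) := by
      ext x; simp
    refine ⟨heq ▸ hm.add hm', ?_⟩
    have h2 : MemLp.toLp _ (heq ▸ hm.add hm') = hm.toLp + hm'.toLp := by
      rw [← MemLp.toLp_add]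
      exact MemLp.toLp_congr _ _ (Eventually.of_forall fun x => congrFun heq x)
    have hpos : ∀ (k : SimpleFunc X ℝ≥0) (h : MemLp (fun x => (k x : ℝ)) p P₀),
        0 ≤ f h.toLp := fun k h => hf _ ((Lp.coeFn_nonneg _).1 (by
      filter_upwards [h.coeFn_toLp] with x hx
      rw [hx]
      exact (k x).coe_nonneg))
    rw [h2, map_add, ENNReal.ofReal_add (hpos g hm) (hpos g' hm'), ← he, ← he',
      ← lintegral_add_left (by fun_prop)]
    simp

/-- The lower integral is a supremum over simple functions, so `g` need not be measurable. This
estimate yields both integrability of `L_p` functions and the density in `L_q`. -/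
theorem lintegral_posMeasure_le (g : X → ℝ≥0∞) :
    ∫⁻ x, g x ∂(posMeasure hp f hf) ≤ ‖f‖ₑ * eLpNorm g p P₀ := by
  rw [lintegral_eq_nnreal]
  refine iSup₂_le fun k hk => ?_
  obtain ⟨h, he⟩ := lintegral_posMeasure_simpleFunc hp hf k
  rw [SimpleFunc.map_lintegral, ← SimpleFunc.map_lintegral, ← SimpleFunc.lintegral_eq_lintegral]
  simp only [SimpleFunc.map_apply]
  rw [he]
  calc ENNReal.ofReal (f h.toLp) ≤ ‖f h.toLp‖ₑ := Real.ofReal_le_enorm _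
    _ ≤ ‖f‖ₑ * ‖h.toLp‖ₑ := f.le_opENorm _
    _ = ‖f‖ₑ * eLpNorm (fun x => (k x : ℝ)) p P₀ := by rw [Lp.enorm_toLp]
    _ ≤ ‖f‖ₑ * eLpNorm g p P₀ := by
      gcongr
      exact eLpNorm_mono_enorm fun x => by simpa using hk x

theorem integrable_posMeasure {v : X → ℝ} (hv : MemLp v p P₀) :
    Integrable v (posMeasure hp f hf) := by
  refine ⟨hv.1.mono_ac (posMeasure_absolutelyContinuous hp hf), ?_⟩
  refine (lintegral_posMeasure_le hp hf _).trans_lt (ENNReal.mul_lt_top (by simp) ?_)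
  rw [eLpNorm_enorm]
  exact hv.2

theorem integral_posMeasure (φ : Lp ℝ p P₀) : ∫ x, φ x ∂(posMeasure hp f hf) = f φ := by
  have hac := posMeasure_absolutelyContinuous hp hf
  have hint : ∀ φ : Lp ℝ p P₀, Integrable φ (posMeasure hp f hf) := fun φ =>
    integrable_posMeasure hp hf (Lp.memLp φ)
  induction φ using Lp.induction hp with
  | indicatorConst c hs hs' =>
    rename_i s
    rw [Lp.simpleFunc.coe_indicatorConst, integral_congr_ae (hac.ae_le indicatorConstLp_coeFn),
      integral_indicator_const c hs, Measure.real, posMeasure_apply hp hf hs,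
      ENNReal.toReal_ofReal (hf _ (indicatorConstLp_one_nonneg hs)), smul_eq_mul, mul_comm,
      ← smul_eq_mul, ← map_smul, indicatorConstLp, indicatorConstLp, ← MemLp.toLp_const_smul]
    congr 1
    refine MemLp.toLp_congr _ _ (Eventually.of_forall fun x => ?_)
    by_cases hx : x ∈ s <;> simp [hx]
  | add hg hg' hd h h' =>
    rw [map_add, ← h, ← h', integral_congr_ae (hac.ae_le (Lp.coeFn_add _ _))]
    exact integral_add (hint _) (hint _)
  | isClosed =>
    refine isClosed_eq ?_ f.continuous
    have : LipschitzWith ‖f‖₊ fun φ : Lp ℝ p P₀ => ∫ x, φ x ∂(posMeasure hp f hf) := by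
      intro φ ψ
      rw [edist_eq_enorm_sub, edist_eq_enorm_sub, ← integral_sub (hint φ) (hint ψ)]
      refine (enorm_integral_le_lintegral_enorm _).trans ?_
      refine (lintegral_posMeasure_le hp hf _).trans (le_of_eq ?_)
      rw [eLpNorm_enorm, Lp.enorm_def, eLpNorm_congr_ae (Lp.coeFn_sub φ ψ)]
      rfl
    exact this.continuous

/-- A measure that is bounded with respect to the norm of `L_p` has a density in `L_q`. -/
theorem memLp_rnDeriv_of_lintegral_le (hp : p ≠ ∞) (hpq : p.HolderConjugate q) {μ : Measure X}
    [IsFiniteMeasure μ] (hac : μ ≪ P₀) {C : ℝ≥0∞} (hC : C ≠ ∞)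
    (h : ∀ g : X → ℝ≥0∞, Measurable g → ∫⁻ x, g x ∂μ ≤ C * eLpNorm g p P₀) :
    MemLp (fun x => (μ.rnDeriv P₀ x).toReal) q P₀ := by
  have hm := Measure.measurable_rnDeriv μ P₀
  have hlt := Measure.rnDeriv_lt_top μ P₀
  refine ⟨hm.ennreal_toReal.aestronglyMeasurable, ?_⟩
  have henorm : ∀ᵐ x ∂P₀, ‖(μ.rnDeriv P₀ x).toReal‖ₑ = ‖μ.rnDeriv P₀ x‖ₑ := by
    filter_upwards [hlt] with x hx
    rw [Real.enorm_of_nonneg ENNReal.toReal_nonneg, ENNReal.ofReal_toReal hx.ne, enorm_eq_self]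
  rw [eLpNorm_congr_enorm_ae henorm]
  rcases (Fact.out : 1 ≤ p).eq_or_lt with rfl | hp1
  -- For `p = 1`, indicators as test functions bound the density by `C` almost everywhere.
  · have hq : q = ∞ := by
      have := hpq.inv_add_inv_eq_inv
      rw [inv_one] at this
      have h2 : q⁻¹ = 0 := by
        have h3 : (1 : ℝ≥0∞) + q⁻¹ = 1 + 0 := by rw [this, add_zero]
        exact (ENNReal.add_right_inj ENNReal.one_ne_top).1 h3
      exact ENNReal.inv_eq_zero.1 h2
    rw [hq, eLpNorm_exponent_top]
    have hle : ∀ᵐ x ∂P₀, μ.rnDeriv P₀ x ≤ C := by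
      refine ae_le_of_forall_setLIntegral_le_of_sigmaFinite hm fun s hs _ => ?_
      rw [Measure.setLIntegral_rnDeriv hac, setLIntegral_const, ← lintegral_indicator_one hs]
      refine (h _ (measurable_one.indicator hs)).trans (le_of_eq ?_)
      rw [eLpNorm_one_eq_lintegral_enorm]
      simp [lintegral_indicator_one hs]
    exact (eLpNormEssSup_le_of_ae_enorm_bound hle).trans_lt hC.lt_top
  · have hq : q ≠ ∞ := by
      rintro rfl
      have := hpq.inv_add_inv_eq_inv
      rw [ENNReal.inv_top, add_zero, inv_one, ENNReal.inv_eq_one] at this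
      exact hp1.ne' this
    have hpq' : p.toReal.HolderConjugate q.toReal := ENNReal.HolderConjugate.toReal_of_ne_top hp hq
    have hq0 : q ≠ 0 := hpq.symm.ne_zero
    have hp0 : p ≠ 0 := (zero_lt_one.trans hp1).ne'
    -- With `r = min (dμ/dP₀) n`, the test function `r^(q-1)` gives `∫ r^q ≤ C (∫ r^q)^(1/p)`.
    -- Truncation makes the integral finite, so the last factor can be divided out.
    have hbound : ∀ n : ℕ, ∫⁻ x, (min (μ.rnDeriv P₀ x) n) ^ q.toReal ∂P₀ ≤ C ^ q.toReal := by
      intro n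
      set A := ∫⁻ x, (min (μ.rnDeriv P₀ x) n) ^ q.toReal ∂P₀ with hA
      have hAtop : A ≠ ∞ := by
        refine ne_top_of_le_ne_top (b := (n : ℝ≥0∞) ^ q.toReal) (by
          exact ENNReal.rpow_ne_top_of_nonneg ENNReal.toReal_nonneg (by simp)) ?_
        calc A ≤ ∫⁻ _, (n : ℝ≥0∞) ^ q.toReal ∂P₀ := lintegral_mono fun x =>
              ENNReal.rpow_le_rpow (min_le_right _ _) ENNReal.toReal_nonneg
          _ = _ := by simp
      have h1 : A ≤ C * A ^ (1 / p.toReal) := by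
        have hg : Measurable fun x => (min (μ.rnDeriv P₀ x) (n : ℝ≥0∞)) ^ (q.toReal - 1) :=
          (hm.min measurable_const).pow_const _
        have h2 := h _ hg
        rw [← lintegral_rnDeriv_mul hac hg.aemeasurable,
          eLpNorm_eq_lintegral_rpow_enorm_toReal hp0 hp] at h2
        simp only [enorm_eq_self, ← ENNReal.rpow_mul, hpq'.symm.sub_one_mul_conj] at h2
        refine le_trans (lintegral_mono fun x => ?_) h2
        have hpos : 0 < q.toReal - 1 := hpq'.symm.sub_one_pos
        calc (min (μ.rnDeriv P₀ x) (n : ℝ≥0∞)) ^ q.toReal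
            = (min (μ.rnDeriv P₀ x) (n : ℝ≥0∞)) ^ (1 + (q.toReal - 1)) := by ring_nf
          _ = min (μ.rnDeriv P₀ x) (n : ℝ≥0∞) *
              (min (μ.rnDeriv P₀ x) (n : ℝ≥0∞)) ^ (q.toReal - 1) := by
            rw [ENNReal.rpow_add_of_nonneg _ _ zero_le_one hpos.le, ENNReal.rpow_one]
          _ ≤ _ := by gcongr; exact min_le_left _ _
      rcases eq_or_ne A 0 with h0 | h0
      · rw [h0]; exact zero_le
      have h3 : A = A ^ (1 / q.toReal) * A ^ (1 / p.toReal) := by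
        rw [← ENNReal.rpow_add _ _ h0 hAtop, one_div, one_div, add_comm,
          hpq'.inv_add_inv_eq_one, ENNReal.rpow_one]
      have h4 : A ^ (1 / q.toReal) ≤ C := by
        have hne : A ^ (1 / p.toReal) ≠ 0 := by
          simp [ENNReal.rpow_eq_zero_iff, h0, hAtop]
        have hne' : A ^ (1 / p.toReal) ≠ ∞ :=
          ENNReal.rpow_ne_top_of_nonneg (by positivity) hAtop
        exact (ENNReal.mul_le_mul_iff_left hne hne').1 (h3 ▸ h1)
      rwa [one_div, ENNReal.rpow_inv_le_iff hpq'.symm.pos] at h4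
    rw [eLpNorm_lt_top_iff_lintegral_rpow_enorm_lt_top hq0 hq]
    simp only [enorm_eq_self]
    refine lt_of_le_of_lt ?_ (ENNReal.rpow_lt_top_of_nonneg (y := q.toReal)
      ENNReal.toReal_nonneg hC)
    have hmono : ∫⁻ x, (μ.rnDeriv P₀ x) ^ q.toReal ∂P₀ ≤
        liminf (fun n : ℕ => ∫⁻ x, (min (μ.rnDeriv P₀ x) n) ^ q.toReal ∂P₀) atTop := by
      refine le_trans (lintegral_mono fun x => ?_)
        (lintegral_liminf_le fun n => (hm.min measurable_const).pow_const _)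
      have ht : Tendsto (fun n : ℕ => (min (μ.rnDeriv P₀ x) (n : ℝ≥0∞)) ^ q.toReal) atTop
          (𝓝 ((μ.rnDeriv P₀ x) ^ q.toReal)) := by
        refine (ENNReal.continuous_rpow_const.tendsto _).comp ?_
        have := (tendsto_const_nhds (x := μ.rnDeriv P₀ x)).min ENNReal.tendsto_nat_nhds_top
        simpa using this
      rw [ht.liminf_eq]
    refine hmono.trans ?_
    exact liminf_le_of_le (h := fun b hb => by
      obtain ⟨n, hn⟩ := hb.exists
      exact hn.trans (hbound n))

open RiskMDP in
theorem posMeasure_mem_probDual (hpq : p.HolderConjugate q) (h1 : f (Lp.const p P₀ 1) = 1) :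
    posMeasure hp f hf ∈ probDual P₀ q := by
  have := isProbabilityMeasure_posMeasure hp hf h1
  have hac := posMeasure_absolutelyContinuous hp hf
  exact ⟨this, hac, memLp_rnDeriv_of_lintegral_le hp hpq hac (C := ‖f‖ₑ) (by simp)
    fun g _ => lintegral_posMeasure_le hp hf g⟩

open RiskMDP in
/-- Functions in `L_p(P₀)` are integrable with respect to the measures in its dual. -/
theorem integrable_of_mem_probDual (hpq : p.HolderConjugate q) {μ : Measure X}
    (hμ : μ ∈ probDual P₀ q) {v : X → ℝ} (hv : MemLp v p P₀) : Integrable v μ := by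
  obtain ⟨_, hac, hd⟩ := hμ
  rw [← integrable_rnDeriv_smul_iff hac]
  have := hpq
  have h1 : MemLp ((fun x => (μ.rnDeriv P₀ x).toReal) * v) 1 P₀ := hv.mul hd
  exact memLp_one_iff_integrable.1 h1

end LpDual

/-! ### Measurability of maps into `L_p`. -/

section MeasurableLp

/-- In a second countable space every open set is a countable union of balls, whose preimages are
sublevel sets of distances. -/
theorem measurable_of_measurable_dist {Ω E : Type*} [MeasurableSpace Ω] [PseudoMetricSpace E]
    [SecondCountableTopology E] [MeasurableSpace E] [BorelSpace E] {f : Ω → E}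
    (h : ∀ e, Measurable fun ω => dist (f ω) e) : Measurable f := by
  refine measurable_of_isOpen fun U hU => ?_
  choose r hr hrU using fun u : U => Metric.isOpen_iff.1 hU u u.2
  obtain ⟨T, hT, hTU⟩ := TopologicalSpace.isOpen_iUnion_countable
    (fun u : U => Metric.ball (u : E) (r u)) fun u => Metric.isOpen_ball
  have hUeq : U = ⋃ u ∈ T, Metric.ball (u : E) (r u) := by
    rw [hTU]
    refine Set.Subset.antisymm (fun u hu => ?_) (Set.iUnion_subset hrU)
    exact Set.mem_iUnion.2 ⟨⟨u, hu⟩, Metric.mem_ball_self (hr _)⟩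
  rw [hUeq, Set.preimage_iUnion₂]
  exact MeasurableSet.biUnion hT fun u _ => measurableSet_lt (h u) measurable_const

/-- The sections of a jointly measurable function form a Borel map into `L_p`. -/
theorem measurable_toLp {Ω X : Type*} [MeasurableSpace Ω] [MeasurableSpace X] {p : ℝ≥0∞}
    [Fact (1 ≤ p)] (hp : p ≠ ∞) {P₀ : Measure X} [IsProbabilityMeasure P₀]
    [MeasurableSpace.CountablyGenerated X] [MeasurableSpace (Lp ℝ p P₀)] [BorelSpace (Lp ℝ p P₀)]
    {g : Ω → X → ℝ} (hg : Measurable (Function.uncurry g)) (hL : ∀ ω, MemLp (g ω) p P₀) :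
    Measurable fun ω => (hL ω).toLp := by
  have : Fact (p ≠ ∞) := ⟨hp⟩
  refine measurable_of_measurable_dist fun φ => ?_
  have hp0 : p ≠ 0 := (zero_lt_one.trans_le Fact.out).ne'
  -- The distance to a fixed `φ` is a function of a parametric integral, hence measurable by
  -- Tonelli.
  have h1 : ∀ ω, dist (hL ω).toLp φ =
      ((∫⁻ y, ‖g ω y - φ y‖ₑ ^ p.toReal ∂P₀) ^ (1 / p.toReal)).toReal := fun ω => by
    rw [Lp.dist_def, ← eLpNorm_congr_ae ((hL ω).coeFn_toLp.symm.sub (ae_eq_refl φ)),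
      eLpNorm_eq_lintegral_rpow_enorm_toReal hp0 hp]
    rfl
  simp only [h1]
  refine (Measurable.pow_const ?_ _).ennreal_toReal
  refine Measurable.lintegral_prod_right' (f := fun z : Ω × X => ‖g z.1 z.2 - φ z.2‖ₑ ^ p.toReal) ?_
  refine Measurable.pow_const (Measurable.enorm ?_) _
  exact hg.sub ((Lp.stronglyMeasurable φ).measurable.comp measurable_snd)

end MeasurableLp

/-! ### Coherent risk measures as monotone sublinear functions. -/

section Coherent

variable {X : Type*} [MeasurableSpace X] {p q : ℝ≥0∞} [Fact (1 ≤ p)] {P₀ : Measure X}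
  [IsProbabilityMeasure P₀] {ρ : Lp ℝ p P₀ → ℝ}

namespace RiskMDP.IsCoherent

theorem map_zero (h : IsCoherent p P₀ ρ) : ρ 0 = 0 := by
  simpa using h.pos_homogeneous 0 0 le_rfl

theorem map_const (h : IsCoherent p P₀ ρ) (a : ℝ) : ρ (Lp.const p P₀ a) = a := by
  simpa [h.map_zero] using h.translation a 0

theorem add_le (h : IsCoherent p P₀ ρ) (φ ψ : Lp ℝ p P₀) : ρ (φ + ψ) ≤ ρ φ + ρ ψ := by
  have h1 := h.convex (1 / 2) φ ψ (by norm_num) (by norm_num)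
  have h2 := h.pos_homogeneous 2 ((1 / 2 : ℝ) • φ + (1 - 1 / 2 : ℝ) • ψ) (by norm_num)
  rw [smul_add, smul_smul, smul_smul] at h2
  norm_num at h1 h2
  linarith

theorem natSublinear (h : IsCoherent p P₀ ρ) : NatSublinear ρ where
  add_le := h.add_le
  nsmul n φ := by
    rw [← h.pos_homogeneous n φ n.cast_nonneg, Nat.cast_smul_eq_nsmul]

theorem exists_bound (h : IsCoherent p P₀ ρ) : ∃ C, ∀ φ, ρ φ ≤ C * ‖φ‖ :=
  exists_bound_of_monotone_sublinear (fun φ ψ => h.mono φ ψ) h.pos_homogeneous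

/-- This and `const_one_of_le` make the representing measure of a subgradient a probability measure:
monotonicity gives positivity, the translation property gives total mass one. -/
theorem nonneg_of_le (h : IsCoherent p P₀ ρ) {f : Lp ℝ p P₀ →L[ℝ] ℝ} (hf : ∀ φ, f φ ≤ ρ φ)
    (φ : Lp ℝ p P₀) (hφ : 0 ≤ φ) : 0 ≤ f φ := by
  have h1 := hf (-φ)
  have h2 := h.mono (-φ) 0 (neg_nonpos.2 hφ)
  rw [h.map_zero] at h2
  rw [_root_.map_neg] at h1
  linarith

theorem const_one_of_le (h : IsCoherent p P₀ ρ) {f : Lp ℝ p P₀ →L[ℝ] ℝ} (hf : ∀ φ, f φ ≤ ρ φ) :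
    f (Lp.const p P₀ 1) = 1 := by
  have h1 := hf (Lp.const p P₀ 1)
  have h2 := hf (Lp.const p P₀ (-1))
  rw [h.map_const] at h1 h2
  rw [_root_.map_neg, _root_.map_neg] at h2
  linarith

/-- Monotonicity and subadditivity applied to `u ≤ d + v`. -/
theorem toLp_sub_le (h : IsCoherent p P₀ ρ) {u v d : X → ℝ} (hu : MemLp u p P₀)
    (hv : MemLp v p P₀) (hd : MemLp d p P₀) (hle : ∀ y, u y - v y ≤ d y) :
    ρ hu.toLp - ρ hv.toLp ≤ ρ hd.toLp := by
  have h1 : hu.toLp ≤ hd.toLp + hv.toLp := by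
    rw [← MemLp.toLp_add, ← Lp.coeFn_le]
    filter_upwards [hu.coeFn_toLp, (hd.add hv).coeFn_toLp] with y h1 h2
    rw [h1, h2]
    simp only [Pi.add_apply]
    linarith [hle y]
  have h2 := h.mono _ _ h1
  have h3 := h.add_le hd.toLp hv.toLp
  linarith

theorem abs_toLp_sub_le (h : IsCoherent p P₀ ρ) {u v d : X → ℝ} (hu : MemLp u p P₀)
    (hv : MemLp v p P₀) (hd : MemLp d p P₀) (hle : ∀ y, |u y - v y| ≤ d y) :
    |ρ hu.toLp - ρ hv.toLp| ≤ ρ hd.toLp := by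
  refine abs_le'.2 ⟨h.toLp_sub_le hu hv hd fun y => (le_abs_self _).trans (hle y), ?_⟩
  rw [neg_sub]
  refine h.toLp_sub_le hv hu hd fun y => le_trans ?_ (hle y)
  rw [← neg_sub]
  exact neg_le_abs _

theorem abs_toLp_le (h : IsCoherent p P₀ ρ) {u d : X → ℝ} (hu : MemLp u p P₀)
    (hd : MemLp d p P₀) (hle : ∀ y, |u y| ≤ d y) : |ρ hu.toLp| ≤ ρ hd.toLp := by
  have h1 := h.abs_toLp_sub_le hu (MemLp.zero (ε := ℝ)) hd (by simpa using hle)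
  rwa [MemLp.toLp_zero, h.map_zero, sub_zero] at h1

end RiskMDP.IsCoherent

end Coherent

/-! ### Measurable selectors of the subdifferentials and the absorbing state. -/

section Selection

variable {X 𝒰 : Type*} [TopologicalSpace X] [MeasurableSpace X] [TopologicalSpace 𝒰]
  [MeasurableSpace 𝒰] {p q : ℝ≥0∞} [Fact (1 ≤ p)] {P₀ : Measure X} [IsProbabilityMeasure P₀]
  {S : Model X 𝒰} {hQ : S.InDual P₀ q} {σ : RiskTransitionMapping p q P₀}

/-- The transition probability `Q(x, π(x))` as an element of the dual space. -/
abbrev transition (hQ : S.InDual P₀ q) (π : Rule S) (x : X) : probDual P₀ q :=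
  ⟨S.Q (π.pt x), hQ (π.pt x)⟩

theorem RiskMDP.Rule.measurable_pt (π : Rule S) : Measurable π.pt :=
  (measurable_id.prodMk π.measurable).subtype_mk

theorem measurable_transition (hQ : S.InDual P₀ q) (π : Rule S) :
    Measurable (transition hQ π) :=
  (S.Q.measurable.comp π.measurable_pt).subtype_mk

theorem measurable_risk_toLp [MeasurableSpace.CountablyGenerated X] (hp : p ≠ ∞) (π : Rule S)
    {g : X → X → ℝ} (hg : Measurable (Function.uncurry g)) (hL : ∀ x, MemLp (g x) p P₀) :
    Measurable fun x => σ.toFun (hL x).toLp x (transition hQ π x) := by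
  let _ : MeasurableSpace (Lp ℝ p P₀) := borel _
  have : BorelSpace (Lp ℝ p P₀) := ⟨rfl⟩
  exact σ.measurable.comp ((measurable_toLp hp hg hL).prodMk
    (measurable_id.prodMk (measurable_transition hQ π)))

/-- Measurable selection of subgradients at which the risk is attained. -/
theorem exists_kernel_subdiff [MeasurableSpace.CountablyGenerated X] (hp : p ≠ ∞)
    (hpq : p.HolderConjugate q) (hQ : S.InDual P₀ q) (σ : RiskTransitionMapping p q P₀)
    (π : Rule S) {g : X → X → ℝ} (hg : Measurable (Function.uncurry g))
    (hL : ∀ x, MemLp (g x) p P₀) :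
    ∃ M : Kernel X X, ∀ x, ∃ μ ∈ σ.subdiff x (transition hQ π x), (μ : Measure X) = M x ∧
      ∫ y, g x y ∂(M x) = σ.toFun (hL x).toLp x (transition hQ π x) := by
  let _ : MeasurableSpace (Lp ℝ p P₀) := borel _
  have : BorelSpace (Lp ℝ p P₀) := ⟨rfl⟩
  have : Fact (p ≠ ∞) := ⟨hp⟩
  have hcoh := fun x => σ.coherent x (transition hQ π x)
  have hjoint : Measurable (Function.uncurry fun x φ => σ.toFun φ x (transition hQ π x)) :=
    σ.measurable.comp (measurable_snd.prodMk
      (measurable_fst.prodMk ((measurable_transition hQ π).comp measurable_fst)))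
  obtain ⟨f, hfm, hfle, hfeq⟩ := exists_measurable_clm_le (fun x => (hcoh x).natSublinear)
    (fun x => (hcoh x).exists_bound) hjoint (measurable_toLp hp hg hL)
  have hpos := fun x => (hcoh x).nonneg_of_le (hfle x)
  have hone := fun x => (hcoh x).const_one_of_le (hfle x)
  refine ⟨⟨fun x => posMeasure hp (f x) (hpos x), ?_⟩, fun x => ?_⟩
  -- On a set `B` the measure is `f x` at the indicator of `B`, so weak measurability of `f` is
  -- enough.
  · refine Measure.measurable_of_measurable_coe _ fun B hB => ?_
    simp only [posMeasure_apply hp (hpos _) hB]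
    exact (hfm _).ennreal_ofReal
  · refine ⟨⟨_, posMeasure_mem_probDual hp (hpos x) hpq (hone x)⟩, fun φ => ?_, rfl, ?_⟩
    · exact (integral_posMeasure hp (hpos x) φ).trans_le (hfle x φ)
    · rw [← hfeq, ← integral_posMeasure hp (hpos x)]
      exact integral_congr_ae ((posMeasure_absolutelyContinuous hp (hpos x)).ae_le
        (hL x).coeFn_toLp.symm)

theorem integral_le_of_mem_subdiff {x : X} {m μ : probDual P₀ q} (hμ : μ ∈ σ.subdiff x m)
    {v : X → ℝ} (hv : MemLp v p P₀) : ∫ y, v y ∂(μ : Measure X) ≤ σ.toFun hv.toLp x m := by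
  rw [← integral_congr_ae (μ.2.2.1.ae_le hv.coeFn_toLp)]
  exact hμ _

theorem measurableEmbedding_eff [MeasurableSingletonClass X] (S : Model X 𝒰) :
    MeasurableEmbedding (Subtype.val : S.Eff → X) :=
  MeasurableEmbedding.subtype_coe (measurableSet_singleton S.xA).compl

theorem lintegral_comap_eff [MeasurableSingletonClass X] (S : Model X 𝒰) (μ : Measure X)
    (v : X → ℝ≥0∞) :
    ∫⁻ y : S.Eff, v y ∂(μ.comap Subtype.val) = ∫⁻ y in {S.xA}ᶜ, v y ∂μ := by
  have hr : Set.range (Subtype.val : S.Eff → X) = {S.xA}ᶜ := by ext y; simp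
  rw [← hr, ← (measurableEmbedding_eff S).map_comap, (measurableEmbedding_eff S).lintegral_map]

/-- The risk of a nonnegative function is bounded by its integral with respect to a selector of
the effective multikernel, up to the value at the absorbing state. -/
theorem exists_selector_risk_le [MeasurableSpace.CountablyGenerated X]
    [MeasurableSingletonClass X] (hp : p ≠ ∞) (hpq : p.HolderConjugate q) (hQ : S.InDual P₀ q)
    (σ : RiskTransitionMapping p q P₀) (π : Rule S) {g : X → X → ℝ}
    (hg : Measurable (Function.uncurry g)) (hL : ∀ x, MemLp (g x) p P₀) (h0 : ∀ x y, 0 ≤ g x y) :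
    ∃ N : Kernel S.Eff S.Eff, IsSelector N (effMultikernel S hQ σ π) ∧
      (∀ x, N x Set.univ ≤ 1) ∧
      ∀ x : S.Eff, ENNReal.ofReal (σ.toFun (hL x).toLp x (transition hQ π x)) ≤
        ∫⁻ y : S.Eff, ENNReal.ofReal (g x y) ∂(N x) + ENNReal.ofReal (g x S.xA) := by
  obtain ⟨M, hM⟩ := exists_kernel_subdiff hp hpq hQ σ π hg hL
  refine ⟨(M.comap Subtype.val measurable_subtype_coe).comapRight
    (measurableEmbedding_eff S), fun x => ?_, fun x => ?_, fun x => ?_⟩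
  · obtain ⟨μ, hμ, he, -⟩ := hM x
    refine ⟨μ, hμ, ?_⟩
    rw [Kernel.comapRight_apply, Kernel.comap_apply, he]
  · obtain ⟨μ, -, he, -⟩ := hM x
    have hprob : IsProbabilityMeasure (M x) := he ▸ μ.2.1
    rw [Kernel.comapRight_apply' _ _ _ MeasurableSet.univ, Kernel.comap_apply]
    exact prob_le_one
  · obtain ⟨μ, -, he, hi⟩ := hM x
    have hprob : IsProbabilityMeasure (M x) := he ▸ μ.2.1
    have hint : Integrable (g x) (M x) := he ▸ integrable_of_mem_probDual hpq μ.2 (hL x)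
    rw [← hi, ofReal_integral_eq_lintegral_ofReal hint (Eventually.of_forall (h0 x)),
      ← lintegral_add_compl _ (measurableSet_singleton S.xA).compl, Kernel.comapRight_apply,
      Kernel.comap_apply, lintegral_comap_eff S _ fun y => ENNReal.ofReal (g x y), compl_compl,
      lintegral_singleton]
    -- What remains is the contribution of the atom `xA`, whose mass is at most one.
    gcongr
    exact mul_le_of_le_one_right zero_le prob_le_one

/-- At the absorbing state, the risk of a function is its value. -/
theorem risk_absorbing [MeasurableSingletonClass X] (hσ : σ.LawInvariant) (π : Rule S)
    {v : X → ℝ} (hv : MemLp v p P₀) :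
    σ.toFun hv.toLp S.xA (transition hQ π S.xA) = v S.xA := by
  have hone : S.Q (π.pt S.xA) {S.xA} = 1 := S.absorbing _ (π.feasible S.xA)
  have hprob := (hQ (π.pt S.xA)).1
  have hac := (hQ (π.pt S.xA)).2.1
  have hA : ∀ᵐ y ∂(S.Q (π.pt S.xA)), y = S.xA := (prob_compl_eq_zero_iff
    (measurableSet_singleton S.xA)).2 hone
  rw [← (σ.coherent S.xA (transition hQ π S.xA)).map_const (v S.xA)]
  -- Under a measure concentrated at `xA`, `v` has the same law as the constant `v S.xA`.
  refine hσ _ _ _ _ (fun η => measure_congr ?_) _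
  filter_upwards [hA, hac.ae_le hv.coeFn_toLp, hac.ae_le (Lp.coeFn_const p P₀ (v S.xA))]
    with y h1 h2 h3
  refine propext ?_
  change (hv.toLp v : X → ℝ) y ≤ η ↔ (Lp.const p P₀ (v S.xA) : X → ℝ) y ≤ η
  rw [h2, h3, h1]
  rfl

end Selection

/-! ### Products of selectors under the transience bound. -/

section KernelProducts

variable {E : Type*} [MeasurableSpace E]

/-- The composition of a list of kernels; the head acts first. -/
noncomputable def kernelProd : List (Kernel E E) → Kernel E E
  | [] => Kernel.id
  | M :: l => kernelProd l ∘ₖ M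

theorem kernelProd_append (l l' : List (Kernel E E)) :
    kernelProd (l ++ l') = kernelProd l' ∘ₖ kernelProd l := by
  induction l with
  | nil => simp [kernelProd]
  | cons M l ih => rw [List.cons_append, kernelProd, ih, Kernel.comp_assoc, kernelProd]

theorem kernelProd_mem_mkPow {𝔐 : E → Set (Measure E)} (l : List (Kernel E E))
    (hl : ∀ M ∈ l, IsSelector M 𝔐) : IsSelector (kernelProd l) (mkPow 𝔐 l.length) := by
  induction l using List.reverseRecOn with
  | nil => exact fun x => Kernel.id_apply x
  | append_singleton l M ih =>
    have hM : IsSelector M 𝔐 := hl M (by simp)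
    have ih' := ih fun N hN => hl N (by simp [hN])
    -- `mkPow` appends factors on the right and treats the exponent `1` separately; hence the
    -- induction from the end of the list and the case of an empty initial part.
    rcases l.eq_nil_or_concat with rfl | ⟨l', N, rfl⟩
    · simpa [kernelProd, mkPow] using hM
    · intro x
      rw [kernelProd_append]
      simp only [List.length_append, List.length_concat, List.length_singleton] at ih' ⊢
      exact ⟨_, M, ih', hM, by simp [kernelProd]⟩

theorem lintegral_le_of_opNorm_le {w : E → ℝ} (hw : ∀ x, 1 ≤ w x) {A : Kernel E E} {K : ℝ≥0∞}
    (h : opNorm w A ≤ K) (x : E) :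
    ∫⁻ y, ENNReal.ofReal (w y) ∂(A x) ≤ K * ENNReal.ofReal (w x) := by
  have h0 : ENNReal.ofReal (w x) ≠ 0 := by
    have := hw x
    simp only [ne_eq, ENNReal.ofReal_eq_zero, not_le]
    linarith
  exact (ENNReal.div_le_iff h0 ENNReal.ofReal_ne_top).1 ((le_iSup _ x).trans h)

variable {w : E → ℝ} {𝔐 : E → Set (Measure E)} {K : ℝ≥0}

/-- The uniform bound for the sums of the powers of a multikernel. -/
def SumBound (w : E → ℝ) (𝔐 : E → Set (Measure E)) (K : ℝ≥0) : Prop :=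
  ∀ (T : ℕ) (M : Kernel E E), IsSelector M (mkSum 𝔐 T) → opNorm w M ≤ K

namespace SumBound

/-- The sum of the prefix products is itself a kernel, and each prefix of length `j` selects from
the `j`-th power, so transience applies to all prefixes at once. -/
theorem sum_le (h : SumBound w 𝔐 K) (hw : ∀ x, 1 ≤ w x) (l : List (Kernel E E))
    (hl : ∀ M ∈ l, IsSelector M 𝔐) (x : E) :
    ∑ j ∈ Finset.Icc 1 l.length, ∫⁻ y, ENNReal.ofReal (w y) ∂(kernelProd (l.take j) x) ≤
      K * ENNReal.ofReal (w x) := by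
  have hs : IsSelector (∑ j ∈ Finset.Icc 1 l.length, kernelProd (l.take j))
      (mkSum 𝔐 l.length) := fun x => by
    rw [_root_.sum_apply]
    refine Set.finsetSum_mem_finsetSum _ _ _ fun j hj => ?_
    have h1 := kernelProd_mem_mkPow (l.take j) (fun M hM => hl M (List.mem_of_mem_take hM)) x
    rwa [List.length_take, min_eq_left (Finset.mem_Icc.1 hj).2] at h1
  have h1 := lintegral_le_of_opNorm_le hw (h _ _ hs) x
  rwa [_root_.sum_apply, lintegral_finsetSum_measure] at h1

/-- A nonempty product is the last term of its prefix sum; the summand `1` covers the empty product,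
the identity. -/
theorem prod_le (h : SumBound w 𝔐 K) (hw : ∀ x, 1 ≤ w x) (hm : Measurable w)
    (l : List (Kernel E E)) (hl : ∀ M ∈ l, IsSelector M 𝔐) (x : E) :
    ∫⁻ y, ENNReal.ofReal (w y) ∂(kernelProd l x) ≤ (1 + K) * ENNReal.ofReal (w x) := by
  rcases l.length.eq_zero_or_pos with h0 | h0
  · rw [List.length_eq_zero_iff.1 h0, kernelProd, Kernel.lintegral_id' hm.ennreal_ofReal]
    exact le_mul_of_one_le_left zero_le le_self_add
  · refine le_trans ?_ ((h.sum_le hw l hl x).trans (mul_le_mul_left le_add_self _))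
    refine le_trans (le_of_eq ?_) (Finset.single_le_sum
      (f := fun j => ∫⁻ y, ENNReal.ofReal (w y) ∂(kernelProd (l.take j) x))
      (fun _ _ => zero_le) (Finset.mem_Icc.2 ⟨h0, le_rfl⟩))
    simp only [List.take_length]

/-- The product of `T` selectors has norm at most `(1 + K) K / T`. -/
theorem length_mul_prod_le (h : SumBound w 𝔐 K) (hw : ∀ x, 1 ≤ w x) (hm : Measurable w)
    (l : List (Kernel E E)) (hl : ∀ M ∈ l, IsSelector M 𝔐) (x : E) :
    (l.length : ℝ≥0∞) * ∫⁻ y, ENNReal.ofReal (w y) ∂(kernelProd l x) ≤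
      (1 + K) * (K * ENNReal.ofReal (w x)) := by
  have h1 : ∀ j ∈ Finset.Icc 1 l.length, ∫⁻ y, ENNReal.ofReal (w y) ∂(kernelProd l x) ≤
      (1 + K) * ∫⁻ y, ENNReal.ofReal (w y) ∂(kernelProd (l.take j) x) := fun j _ => by
    -- Cut the product after `j` factors: the remaining ones send `w` below `(1 + K) w`.
    conv_lhs => rw [← List.take_append_drop j l]
    rw [kernelProd_append, Kernel.lintegral_comp _ _ _ hm.ennreal_ofReal,
      ← lintegral_const_mul _ hm.ennreal_ofReal]
    exact lintegral_mono fun y =>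
      h.prod_le hw hm _ (fun M hM => hl M (List.mem_of_mem_drop hM)) y
  have h2 := Finset.sum_le_sum h1
  rw [Finset.sum_const, Nat.card_Icc, add_tsub_cancel_right, nsmul_eq_mul, ← Finset.mul_sum] at h2
  exact h2.trans (mul_le_mul_right (h.sum_le hw l hl x) _)

end SumBound

/-- Unrolls the recursion. The latest kernel `N (T - 1)` acts first, which is why the list is
reversed; `A` collects the source terms and `B` the initial value. -/
theorem le_sum_kernelProd {W : E → ℝ≥0∞} (hW : Measurable W) {u : ℕ → E → ℝ≥0∞}
    {N : ℕ → Kernel E E} {A B : ℝ≥0∞} (h0 : ∀ x, u 0 x ≤ B * W x)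
    (hu : ∀ t x, u (t + 1) x ≤ A * W x + ∫⁻ y, u t y ∂(N t x)) (T : ℕ) (x : E) :
    u T x ≤ A * ∑ j ∈ Finset.range T,
        ∫⁻ y, W y ∂(kernelProd (((List.range T).map N).reverse.take j) x) +
      B * ∫⁻ y, W y ∂(kernelProd ((List.range T).map N).reverse x) := by
  induction T generalizing x with
  | zero => simpa [kernelProd, Kernel.lintegral_id' hW] using h0 x
  | succ T ih =>
    have hl : ((List.range (T + 1)).map N).reverse = N T :: ((List.range T).map N).reverse := by
      simp [List.range_succ]
    rw [hl, Finset.sum_range_succ']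
    simp only [List.take_succ_cons, List.take_zero, kernelProd, Kernel.lintegral_comp _ _ _ hW,
      Kernel.lintegral_id' hW]
    have hmeas : ∀ l : List (Kernel E E), Measurable fun y => ∫⁻ z, W z ∂(kernelProd l y) :=
      fun l => hW.lintegral_kernel
    refine (hu T x).trans ?_
    refine (add_le_add_right (lintegral_mono fun y => ih y) _).trans (le_of_eq ?_)
    rw [lintegral_add_right _ ((hmeas _).const_mul _), lintegral_const_mul _ (hmeas _),
      lintegral_const_mul _ (Finset.measurable_fun_sum _ fun j _ => hmeas _),
      lintegral_finsetSum _ fun j _ => hmeas _]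
    ring

namespace SumBound

theorem uniform_bound (h : SumBound w 𝔐 K) (hw : ∀ x, 1 ≤ w x) (hm : Measurable w)
    {u : ℕ → E → ℝ≥0∞} {N : ℕ → Kernel E E} (hN : ∀ t, IsSelector (N t) 𝔐) {A : ℝ≥0∞}
    (h0 : ∀ x, u 0 x = 0)
    (hu : ∀ t x, u (t + 1) x ≤ A * ENNReal.ofReal (w x) + ∫⁻ y, u t y ∂(N t x))
    (T : ℕ) (x : E) : u T x ≤ A * ((1 + K) * ENNReal.ofReal (w x)) := by
  have h1 := le_sum_kernelProd (B := 0) hm.ennreal_ofReal (fun x => (h0 x).le.trans zero_le) hu T x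
  rw [zero_mul, add_zero] at h1
  refine h1.trans (mul_le_mul_right ?_ _)
  rcases T with _ | T
  · simp
  set l := ((List.range (T + 1)).map N).reverse with hl
  have hsel : ∀ M ∈ l, IsSelector M 𝔐 := fun M hM => by
    simp only [hl, List.mem_reverse, List.mem_map] at hM
    obtain ⟨t, -, rfl⟩ := hM
    exact hN t
  have hlen : l.length = T + 1 := by simp [hl]
  have h2 := h.sum_le hw l hsel x
  -- The prefix of length `0` is the identity and accounts for the `1` in `1 + K`; the others lie in
  -- the range of `sum_le`.
  rw [Finset.sum_range_succ', add_mul, one_mul, List.take_zero, kernelProd,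
    Kernel.lintegral_id' hm.ennreal_ofReal, add_comm]
  refine add_le_add_right (le_trans ?_ h2) _
  rw [← Finset.sum_image (s := Finset.range T) (g := fun j => j + 1)
    (f := fun j => ∫⁻ y, ENNReal.ofReal (w y) ∂(kernelProd (l.take j) x)) (by simp)]
  refine Finset.sum_le_sum_of_subset fun j hj => ?_
  simp only [Finset.mem_image, Finset.mem_range, Finset.mem_Icc] at hj ⊢
  omega

theorem decay (h : SumBound w 𝔐 K) (hw : ∀ x, 1 ≤ w x) (hm : Measurable w)
    {u : ℕ → E → ℝ≥0∞} {N : ℕ → Kernel E E} (hN : ∀ t, IsSelector (N t) 𝔐) {B : ℝ≥0∞}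
    (h0 : ∀ x, u 0 x ≤ B * ENNReal.ofReal (w x))
    (hu : ∀ t x, u (t + 1) x ≤ ∫⁻ y, u t y ∂(N t x))
    (T : ℕ) (x : E) : T * u T x ≤ B * ((1 + K) * (K * ENNReal.ofReal (w x))) := by
  have h1 := le_sum_kernelProd (A := 0) hm.ennreal_ofReal h0 (by simpa using hu) T x
  rw [zero_mul, zero_add] at h1
  set l := ((List.range T).map N).reverse with hl
  have hsel : ∀ M ∈ l, IsSelector M 𝔐 := fun M hM => by
    simp only [hl, List.mem_reverse, List.mem_map] at hM
    obtain ⟨t, -, rfl⟩ := hM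
    exact hN t
  have hlen : l.length = T := by simp [hl]
  have h2 := h.length_mul_prod_le hw hm l hsel x
  rw [hlen] at h2
  calc (T : ℝ≥0∞) * u T x ≤ T * (B * _) := mul_le_mul_right h1 _
    _ = B * (T * _) := by ring
    _ ≤ _ := mul_le_mul_right h2 _

end SumBound

end KernelProducts

/-! ### Bounds and convergence of the nested risks. -/

section NestedRisk

variable {X 𝒰 : Type*} [TopologicalSpace X] [MeasurableSpace X] [TopologicalSpace 𝒰]
  [MeasurableSpace 𝒰] {p q : ℝ≥0∞} [Fact (1 ≤ p)] {P₀ : Measure X} [IsProbabilityMeasure P₀]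
  {S : Model X 𝒰} {hQ : S.InDual P₀ q} {σ : RiskTransitionMapping p q P₀} {w : X → ℝ}
  {π : Rule S} {C : ℝ} {K : ℝ≥0}

/-- The standing assumptions on a transient rule, with explicit constants. -/
structure TransientRule (hQ : S.InDual P₀ q) (σ : RiskTransitionMapping p q P₀) (w : X → ℝ)
    (C : ℝ) (K : ℝ≥0) (π : Rule S) : Prop where
  p_ne_top : p ≠ ∞
  conj : p.HolderConjugate q
  lawInvariant : σ.LawInvariant
  weight : IsWeight w p P₀
  cost_measurable : Measurable fun z : X × 𝒰 × X => S.c z.1 z.2.1 z.2.2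
  C_nonneg : 0 ≤ C
  cost_bound : ∀ x, ∀ u ∈ S.U x, ∀ y, |S.c x u y| ≤ C * (w x + w y)
  estimate : TransienceEstimate S hQ σ w π K

/-- Measurable `w`-bounded functions that vanish at the absorbing state. -/
structure Admissible (S : Model X 𝒰) (w v : X → ℝ) : Prop where
  measurable : Measurable v
  absorbing : v S.xA = 0
  bounded : ∃ D, ∀ x, |v x| ≤ D * w x

/-- The one-step operator `v ↦ σ(c(x, π(x), ·) + v, x, Q(x, π(x)))`. -/
noncomputable def riskStep (hQ : S.InDual P₀ q) (σ : RiskTransitionMapping p q P₀) (π : Rule S)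
    (v : X → ℝ) : X → ℝ :=
  oneStepRisk S hQ σ π fun x u y => S.c x u y + v y

theorem RiskMDP.IsWeight.memLp_of_abs_le (hw : IsWeight w p P₀) {v : X → ℝ} (hv : Measurable v)
    {a b : ℝ} (h : ∀ y, |v y| ≤ a + b * w y) : MemLp v p P₀ :=
  MemLp.mono' ((memLp_const a).add (hw.memLp.const_mul b)) hv.aestronglyMeasurable
    (Eventually.of_forall h)

theorem RiskMDP.IsWeight.nonneg (hw : IsWeight w p P₀) (x : X) : 0 ≤ w x :=
  zero_le_one.trans (hw.one_le x)

namespace TransientRule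

variable {v v' : X → ℝ}

theorem measurable_cost_add (h : TransientRule hQ σ w C K π) (hv : Measurable v) :
    Measurable (Function.uncurry fun x y => S.c x (π.toFun x) y + v y) :=
  (h.cost_measurable.comp (measurable_fst.prodMk
    ((π.measurable.comp measurable_fst).prodMk measurable_snd))).add (hv.comp measurable_snd)

theorem abs_cost_add_le (h : TransientRule hQ σ w C K π) (x y : X) :
    |S.c x (π.toFun x) y + v y| ≤ C * (w x + w y) + |v y| :=
  (abs_add_le _ _).trans (add_le_add_left (h.cost_bound x _ (π.feasible x) y) _)

theorem memLp_cost_add (h : TransientRule hQ σ w C K π) (hv : Admissible S w v) (x : X) :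
    MemLp (fun y => S.c x (π.toFun x) y + v y) p P₀ := by
  obtain ⟨D, hD⟩ := hv.bounded
  refine h.weight.memLp_of_abs_le (a := C * w x) (b := C + D)
    ((h.measurable_cost_add hv.measurable).comp measurable_prodMk_left) fun y => ?_
  have := h.abs_cost_add_le (v := v) x y
  have := hD y
  linarith

theorem riskStep_eq (h : TransientRule hQ σ w C K π) (hv : Admissible S w v) (x : X) :
    riskStep hQ σ π v x = σ.toFun (h.memLp_cost_add hv x).toLp x (transition hQ π x) :=
  dif_pos (h.memLp_cost_add hv x)

theorem riskStep_absorbing [MeasurableSingletonClass X] (h : TransientRule hQ σ w C K π)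
    (hv : Admissible S w v) : riskStep hQ σ π v S.xA = 0 := by
  rw [h.riskStep_eq hv, risk_absorbing h.lawInvariant π, hv.absorbing,
    S.cost_absorbing _ (π.feasible _), add_zero]

theorem measurable_riskStep [MeasurableSpace.CountablyGenerated X]
    (h : TransientRule hQ σ w C K π) (hv : Admissible S w v) :
    Measurable (riskStep hQ σ π v) := by
  rw [funext (h.riskStep_eq hv)]
  exact measurable_risk_toLp h.p_ne_top π (h.measurable_cost_add hv.measurable)
    (h.memLp_cost_add hv)

theorem sumBound (h : TransientRule hQ σ w C K π) :
    SumBound (fun x : S.Eff => w x) (effMultikernel S hQ σ π) K := h.estimate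

theorem one_le_weight (h : TransientRule hQ σ w C K π) (x : S.Eff) : 1 ≤ w x :=
  h.weight.one_le x

theorem measurable_weight (h : TransientRule hQ σ w C K π) :
    Measurable fun x : S.Eff => w x :=
  h.weight.measurable.comp measurable_subtype_coe

theorem lintegral_weight_le (h : TransientRule hQ σ w C K π) {N : Kernel S.Eff S.Eff}
    (hN : IsSelector N (effMultikernel S hQ σ π)) (x : S.Eff) :
    ∫⁻ y : S.Eff, ENNReal.ofReal (w y) ∂(N x) ≤ (1 + K) * ENNReal.ofReal (w x) := by
  simpa [kernelProd] using h.sumBound.prod_le h.one_le_weight h.measurable_weight [N]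
    (by simpa using hN) x

/-- The constant in the bound of the one-step risk. -/
noncomputable def stepConst (S : Model X 𝒰) (w : X → ℝ) (C : ℝ) (K : ℝ≥0) : ℝ :=
  C * (3 + K + w S.xA)

theorem stepConst_nonneg (h : TransientRule hQ σ w C K π) : 0 ≤ stepConst S w C K :=
  mul_nonneg h.C_nonneg (by have := h.weight.nonneg S.xA; positivity)

variable [MeasurableSpace.CountablyGenerated X] [MeasurableSingletonClass X]

/-- The selector is chosen for the dominating function `C (w x + w y) + |v y|` rather than for `c +
v`. The result is the recursion needed by `SumBound.uniform_bound`. -/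
theorem abs_riskStep_le (h : TransientRule hQ σ w C K π) (hv : Admissible S w v) :
    ∃ N : Kernel S.Eff S.Eff, IsSelector N (effMultikernel S hQ σ π) ∧ ∀ x : S.Eff,
      ENNReal.ofReal |riskStep hQ σ π v x| ≤
        ENNReal.ofReal (stepConst S w C K) * ENNReal.ofReal (w x) +
          ∫⁻ y : S.Eff, ENNReal.ofReal |v y| ∂(N x) := by
  have hw := h.weight.nonneg
  have hC := h.C_nonneg
  have hg : Measurable (Function.uncurry fun x y => C * (w x + w y) + |v y|) := by
    have h1 := h.weight.measurable
    have h2 : Measurable fun y => |v y| := hv.measurable.abs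
    exact (((h1.comp measurable_fst).add (h1.comp measurable_snd)).const_mul C).add
      (h2.comp measurable_snd)
  have h0 : ∀ x y, 0 ≤ C * (w x + w y) + |v y| := fun x y =>
    add_nonneg (mul_nonneg hC (add_nonneg (hw x) (hw y))) (abs_nonneg _)
  have hL : ∀ x, MemLp (fun y => C * (w x + w y) + |v y|) p P₀ := fun x => by
    obtain ⟨D, hD⟩ := hv.bounded
    refine h.weight.memLp_of_abs_le (a := C * w x) (b := C + D)
      (hg.comp measurable_prodMk_left) fun y => ?_
    rw [abs_of_nonneg (h0 x y)]
    linarith [hD y]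
  obtain ⟨N, hN, hN1, hle⟩ := exists_selector_risk_le h.p_ne_top h.conj hQ σ π hg hL h0
  refine ⟨N, hN, fun x => ?_⟩
  rw [h.riskStep_eq hv]
  refine (ENNReal.ofReal_le_ofReal ((σ.coherent _ _).abs_toLp_le (h.memLp_cost_add hv x) (hL x)
    fun y => h.abs_cost_add_le x y)).trans ((hle x).trans ?_)
  have hWm : Measurable fun y : S.Eff => ENNReal.ofReal (w y) := h.measurable_weight.ennreal_ofReal
  have hsplit : ∀ y : S.Eff, ENNReal.ofReal (C * (w x + w y) + |v y|) =
      ENNReal.ofReal C * ENNReal.ofReal (w x) + ENNReal.ofReal C * ENNReal.ofReal (w y) +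
        ENNReal.ofReal |v y| := fun y => by
    rw [ENNReal.ofReal_add (mul_nonneg hC (add_nonneg (hw x) (hw y))) (abs_nonneg _),
      ENNReal.ofReal_mul hC, ENNReal.ofReal_add (hw x) (hw y), mul_add]
  simp only [hsplit]
  rw [lintegral_add_left ((hWm.const_mul _).const_add _), lintegral_add_left measurable_const,
    lintegral_const, lintegral_const_mul _ hWm, add_right_comm]
  gcongr
  -- The three parts of `stepConst`: `C` from `w x`, `C (1 + K)` from the integral of `w y`, and `C
  -- (1 + w xA)` from the absorbing state, using `1 ≤ w x`.
  have h1 : ENNReal.ofReal C * ENNReal.ofReal (w x) * N x Set.univ ≤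
      ENNReal.ofReal C * ENNReal.ofReal (w x) := mul_le_of_le_one_right zero_le (hN1 x)
  have h2 : ENNReal.ofReal C * ∫⁻ y : S.Eff, ENNReal.ofReal (w y) ∂(N x) ≤
      ENNReal.ofReal C * ((1 + K) * ENNReal.ofReal (w x)) :=
    mul_le_mul_right (h.lintegral_weight_le hN x) _
  have h3 : ENNReal.ofReal (C * (w x + w S.xA) + |v S.xA|) ≤
      ENNReal.ofReal C * ((1 + ENNReal.ofReal (w S.xA)) * ENNReal.ofReal (w x)) := by
    rw [hv.absorbing, abs_zero, add_zero, ENNReal.ofReal_mul hC, ENNReal.ofReal_add (hw x) (hw _),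
      add_mul, one_mul]
    gcongr
    refine le_mul_of_one_le_right zero_le ?_
    rw [← ENNReal.ofReal_one]
    exact ENNReal.ofReal_le_ofReal (h.weight.one_le x)
  refine (add_le_add (add_le_add h1 h2) h3).trans (le_of_eq ?_)
  rw [stepConst, ENNReal.ofReal_mul hC, ENNReal.ofReal_add (by positivity) (hw _),
    ENNReal.ofReal_add (by positivity) K.coe_nonneg, ENNReal.ofReal_coe_nnreal,
    show ENNReal.ofReal 3 = 3 by simp]
  ring

/-- The common cost cancels, and `v - v'` vanishes at the absorbing state, so no source term is
left. -/
theorem abs_riskStep_sub_le (h : TransientRule hQ σ w C K π) (hv : Admissible S w v)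
    (hv' : Admissible S w v') :
    ∃ N : Kernel S.Eff S.Eff, IsSelector N (effMultikernel S hQ σ π) ∧ ∀ x : S.Eff,
      ENNReal.ofReal |riskStep hQ σ π v x - riskStep hQ σ π v' x| ≤
          ∫⁻ y : S.Eff, ENNReal.ofReal |v y - v' y| ∂(N x) := by
  have hgm : Measurable fun y => |v y - v' y| := (hv.measurable.sub hv'.measurable).abs
  have hL : MemLp (fun y => |v y - v' y|) p P₀ := by
    obtain ⟨D, hD⟩ := hv.bounded
    obtain ⟨D', hD'⟩ := hv'.bounded
    refine h.weight.memLp_of_abs_le (a := 0) (b := D + D') hgm fun y => ?_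
    rw [abs_abs]
    have := abs_sub (v y) (v' y)
    have := hD y
    have := hD' y
    linarith
  obtain ⟨N, hN, -, hle⟩ := exists_selector_risk_le h.p_ne_top h.conj hQ σ π
    (g := fun _ y => |v y - v' y|) (hgm.comp measurable_snd) (fun _ => hL)
    fun _ _ => abs_nonneg _
  refine ⟨N, hN, fun x => ?_⟩
  rw [h.riskStep_eq hv, h.riskStep_eq hv']
  refine (ENNReal.ofReal_le_ofReal ((σ.coherent _ _).abs_toLp_sub_le (h.memLp_cost_add hv x)
    (h.memLp_cost_add hv' x) hL fun y => ?_)).trans ((hle x).trans ?_)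
  · rw [add_sub_add_left_eq_sub]
  · simp [hv.absorbing, hv'.absorbing]

theorem admissible_of_le (h : TransientRule hQ σ w C K π) (hm : Measurable v) (h0 : v S.xA = 0)
    {D : ℝ} (hD0 : 0 ≤ D) (hD : ∀ x : S.Eff, |v x| ≤ D * w x) : Admissible S w v := by
  refine ⟨hm, h0, D, fun x => ?_⟩
  by_cases hx : x = S.xA
  · rw [hx, h0, abs_zero]
    exact mul_nonneg hD0 (h.weight.nonneg _)
  · exact hD ⟨x, hx⟩

theorem le_of_ofReal_le (h : TransientRule hQ σ w C K π) {a D : ℝ} (hD : 0 ≤ D) {x : X}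
    (hle : ENNReal.ofReal a ≤ ENNReal.ofReal D * ENNReal.ofReal (w x)) : a ≤ D * w x := by
  rw [← ENNReal.ofReal_mul hD] at hle
  exact (ENNReal.ofReal_le_ofReal_iff (mul_nonneg hD (h.weight.nonneg x))).1 hle

theorem admissible_riskStep (h : TransientRule hQ σ w C K π) (hv : Admissible S w v) :
    Admissible S w (riskStep hQ σ π v) := by
  obtain ⟨N, hN, hle⟩ := h.abs_riskStep_le hv
  obtain ⟨D, hD⟩ := hv.bounded
  have hD0 : 0 ≤ D := by
    have h1 := (abs_nonneg _).trans (hD S.xA)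
    have h2 := h.weight.one_le S.xA
    by_contra! hneg
    nlinarith
  have hA := h.stepConst_nonneg
  refine h.admissible_of_le (h.measurable_riskStep hv) (h.riskStep_absorbing hv)
    (D := stepConst S w C K + D * (1 + K)) (by positivity) fun x => ?_
  refine h.le_of_ofReal_le (by positivity) ((hle x).trans ?_)
  rw [ENNReal.ofReal_add hA (by positivity), add_mul]
  gcongr
  calc ∫⁻ y : S.Eff, ENNReal.ofReal |v y| ∂(N x)
      ≤ ∫⁻ y : S.Eff, ENNReal.ofReal D * ENNReal.ofReal (w y) ∂(N x) :=
        lintegral_mono fun y => by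
          rw [← ENNReal.ofReal_mul hD0]
          exact ENNReal.ofReal_le_ofReal (hD y)
    _ = ENNReal.ofReal D * ∫⁻ y : S.Eff, ENNReal.ofReal (w y) ∂(N x) :=
        lintegral_const_mul _ h.measurable_weight.ennreal_ofReal
    _ ≤ ENNReal.ofReal D * ((1 + K) * ENNReal.ofReal (w x)) :=
        mul_le_mul_right (h.lintegral_weight_le hN x) _
    _ = _ := by
        rw [ENNReal.ofReal_mul hD0, ENNReal.ofReal_add zero_le_one K.coe_nonneg,
          ENNReal.ofReal_coe_nnreal, ENNReal.ofReal_one, mul_assoc]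

theorem admissible_nestedRisk (h : TransientRule hQ σ w C K π) (T : ℕ) :
    Admissible S w (nestedRisk S hQ σ π T) := by
  induction T with
  | zero => exact ⟨measurable_const, rfl, 0, fun x => by simp [nestedRisk]⟩
  | succ T ih => exact h.admissible_riskStep ih

/-- The constant in the uniform bound of the nested risks. -/
noncomputable def riskConst (S : Model X 𝒰) (w : X → ℝ) (C : ℝ) (K : ℝ≥0) : ℝ :=
  stepConst S w C K * (1 + K)

theorem riskConst_nonneg (h : TransientRule hQ σ w C K π) : 0 ≤ riskConst S w C K :=
  mul_nonneg h.stepConst_nonneg (by positivity)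

theorem abs_nestedRisk_le (h : TransientRule hQ σ w C K π) (T : ℕ) (x : X) :
    |nestedRisk S hQ σ π T x| ≤ riskConst S w C K * w x := by
  by_cases hx : x = S.xA
  · rw [hx, (h.admissible_nestedRisk T).absorbing, abs_zero]
    exact mul_nonneg h.riskConst_nonneg (h.weight.nonneg _)
  choose N hN hle using fun t => h.abs_riskStep_le (h.admissible_nestedRisk t)
  have h1 := h.sumBound.uniform_bound h.one_le_weight h.measurable_weight
    (u := fun t x => ENNReal.ofReal |nestedRisk S hQ σ π t x|) hN
    (fun x => by simp [nestedRisk]) hle T ⟨x, hx⟩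
  refine h.le_of_ofReal_le h.riskConst_nonneg (h1.trans (le_of_eq ?_))
  rw [riskConst, ENNReal.ofReal_mul h.stepConst_nonneg, ENNReal.ofReal_add zero_le_one K.coe_nonneg,
    ENNReal.ofReal_coe_nnreal, ENNReal.ofReal_one, mul_assoc]

/-- The constant in the rate of convergence of the nested risks. -/
noncomputable def rateConst (S : Model X 𝒰) (w : X → ℝ) (C : ℝ) (K : ℝ≥0) : ℝ :=
  riskConst S w C K * ((1 + K) * K)

theorem rateConst_nonneg (h : TransientRule hQ σ w C K π) : 0 ≤ rateConst S w C K :=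
  mul_nonneg h.riskConst_nonneg (by positivity)

/-- Both horizons shrink together: after `T` steps the difference is that of `J_n` and `J_0 = 0`,
which is `w`-bounded uniformly in `n`, and `SumBound.decay` applies. -/
theorem mul_abs_nestedRisk_sub_le (h : TransientRule hQ σ w C K π) (T n : ℕ) (x : X) :
    T * |nestedRisk S hQ σ π (T + n) x - nestedRisk S hQ σ π T x| ≤ rateConst S w C K * w x := by
  by_cases hx : x = S.xA
  · rw [hx, (h.admissible_nestedRisk T).absorbing, (h.admissible_nestedRisk _).absorbing, sub_zero,
      abs_zero, mul_zero]
    exact mul_nonneg h.rateConst_nonneg (h.weight.nonneg _)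
  choose N hN hle using fun t => h.abs_riskStep_sub_le (h.admissible_nestedRisk (t + n))
    (h.admissible_nestedRisk t)
  have h1 := h.sumBound.decay h.one_le_weight h.measurable_weight
    (u := fun t x => ENNReal.ofReal |nestedRisk S hQ σ π (t + n) x - nestedRisk S hQ σ π t x|) hN
    (B := ENNReal.ofReal (riskConst S w C K)) (fun x => by
      rw [← ENNReal.ofReal_mul h.riskConst_nonneg]
      refine ENNReal.ofReal_le_ofReal ?_
      simpa [nestedRisk] using h.abs_nestedRisk_le n x)
    (fun t x => by
      have := hle t x
      rw [Nat.add_right_comm]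
      exact this) T ⟨x, hx⟩
  refine h.le_of_ofReal_le h.rateConst_nonneg (le_trans (le_of_eq ?_) (h1.trans (le_of_eq ?_)))
  · rw [ENNReal.ofReal_mul (by positivity), ENNReal.ofReal_natCast]
  · rw [rateConst, ENNReal.ofReal_mul h.riskConst_nonneg, ENNReal.ofReal_mul (by positivity),
      ENNReal.ofReal_add zero_le_one K.coe_nonneg, ENNReal.ofReal_coe_nnreal, ENNReal.ofReal_one,
      mul_assoc, mul_assoc]

theorem tendsto_nestedRisk (h : TransientRule hQ σ w C K π) (x : X) :
    Tendsto (fun T => nestedRisk S hQ σ π T x) atTop (𝓝 (infiniteRisk S hQ σ π x)) := by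
  suffices hc : CauchySeq fun T => nestedRisk S hQ σ π T x by
    obtain ⟨a, ha⟩ := cauchySeq_tendsto_of_complete hc
    rw [infiniteRisk, ha.limUnder_eq]
    exact ha
  refine Metric.cauchySeq_iff'.2 fun ε hε => ?_
  obtain ⟨T, hT⟩ := exists_nat_gt (rateConst S w C K * w x / ε)
  refine ⟨T, fun m hm => ?_⟩
  obtain ⟨n, rfl⟩ := Nat.exists_eq_add_of_le hm
  have h1 := h.mul_abs_nestedRisk_sub_le T n x
  rw [div_lt_iff₀ hε] at hT
  rw [Real.dist_eq]
  have hpos : (0 : ℝ) < T := by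
    have h2 := mul_nonneg h.rateConst_nonneg (h.weight.nonneg x)
    by_contra! h3
    nlinarith
  exact lt_of_mul_lt_mul_left (h1.trans_lt hT) hpos.le

theorem abs_infiniteRisk_le (h : TransientRule hQ σ w C K π) (x : X) :
    |infiniteRisk S hQ σ π x| ≤ riskConst S w C K * w x :=
  le_of_tendsto' (h.tendsto_nestedRisk x).abs fun T => h.abs_nestedRisk_le T x

theorem mul_abs_infiniteRisk_sub_le (h : TransientRule hQ σ w C K π) (T : ℕ) (x : X) :
    T * |infiniteRisk S hQ σ π x - nestedRisk S hQ σ π T x| ≤ rateConst S w C K * w x := by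
  have h1 : Tendsto (fun n => nestedRisk S hQ σ π (T + n) x) atTop
      (𝓝 (infiniteRisk S hQ σ π x)) := by
    simpa only [add_comm] using (tendsto_add_atTop_iff_nat T).2 (h.tendsto_nestedRisk x)
  exact le_of_tendsto' ((h1.sub_const _).abs.const_mul _) fun n =>
    h.mul_abs_nestedRisk_sub_le T n x

theorem abs_nestedRisk_sub_infiniteRisk_le (h : TransientRule hQ σ w C K π) {T : ℕ} (hT : 0 < T)
    (x : X) : |nestedRisk S hQ σ π T x - infiniteRisk S hQ σ π x| ≤
      rateConst S w C K / T * w x := by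
  have h1 := h.mul_abs_infiniteRisk_sub_le T x
  have hpos : (0 : ℝ) < T := Nat.cast_pos.2 hT
  rw [abs_sub_comm, div_mul_eq_mul_div, le_div_iff₀ hpos]
  linarith

theorem infiniteRisk_absorbing (h : TransientRule hQ σ w C K π) :
    infiniteRisk S hQ σ π S.xA = 0 :=
  tendsto_nhds_unique (h.tendsto_nestedRisk S.xA)
    (by simp only [(h.admissible_nestedRisk _).absorbing]; exact tendsto_const_nhds)

theorem admissible_infiniteRisk (h : TransientRule hQ σ w C K π) :
    Admissible S w (infiniteRisk S hQ σ π) :=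
  ⟨measurable_of_tendsto_metrizable (fun T => (h.admissible_nestedRisk T).measurable)
    (tendsto_pi_nhds.2 h.tendsto_nestedRisk), h.infiniteRisk_absorbing, _, h.abs_infiniteRisk_le⟩

theorem memLp_of_admissible (h : TransientRule hQ σ w C K π) (hv : Admissible S w v) :
    MemLp v p P₀ := by
  obtain ⟨D, hD⟩ := hv.bounded
  exact h.weight.memLp_of_abs_le (a := 0) (b := D) hv.measurable fun y => by
    rw [zero_add]
    exact hD y

theorem wNorm_le_of_abs_le (h : TransientRule hQ σ w C K π) {D : ℝ}
    (hD : ∀ x, |v x| ≤ D * w x) :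
    wNorm (fun x : S.Eff => w x) (fun x : S.Eff => v x) ≤ ENNReal.ofReal D :=
  iSup_le fun x => ENNReal.ofReal_le_ofReal
    ((div_le_iff₀ (zero_lt_one.trans_le (h.weight.one_le x))).2 (hD x))

theorem tendsto_ofReal_rate (S : Model X 𝒰) (w : X → ℝ) (C : ℝ) (K : ℝ≥0) :
    Tendsto (fun T : ℕ => ENNReal.ofReal (rateConst S w C K / T)) atTop (𝓝 0) := by
  rw [← ENNReal.ofReal_zero]
  exact ENNReal.tendsto_ofReal (tendsto_const_div_atTop_nhds_zero_nat _)

theorem tendsto_wNorm (h : TransientRule hQ σ w C K π) :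
    Tendsto (fun T => wNorm (fun x : S.Eff => w x)
      (fun x : S.Eff => nestedRisk S hQ σ π T x - infiniteRisk S hQ σ π x)) atTop (𝓝 0) := by
  refine tendsto_of_tendsto_of_tendsto_of_le_of_le' tendsto_const_nhds
    (tendsto_ofReal_rate S w C K) (Eventually.of_forall fun _ => zero_le) ?_
  filter_upwards [eventually_gt_atTop 0] with T hT
  exact h.wNorm_le_of_abs_le (v := fun x => nestedRisk S hQ σ π T x - infiniteRisk S hQ σ π x)
    (h.abs_nestedRisk_sub_infiniteRisk_le hT)

theorem tendsto_eLpNorm (h : TransientRule hQ σ w C K π) :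
    Tendsto (fun T => eLpNorm (nestedRisk S hQ σ π T - infiniteRisk S hQ σ π) p P₀)
      atTop (𝓝 0) := by
  have h1 : Tendsto (fun T : ℕ => ENNReal.ofReal (rateConst S w C K / T) * eLpNorm w p P₀) atTop
      (𝓝 0) := by
    have := ENNReal.Tendsto.mul_const (b := eLpNorm w p P₀) (tendsto_ofReal_rate S w C K)
      (Or.inr h.weight.memLp.2.ne)
    rwa [zero_mul] at this
  refine tendsto_of_tendsto_of_tendsto_of_le_of_le' tendsto_const_nhds h1
    (Eventually.of_forall fun _ => zero_le) ?_
  filter_upwards [eventually_gt_atTop 0] with T hT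
  refine eLpNorm_le_mul_eLpNorm_of_ae_le_mul (Eventually.of_forall fun x => ?_) p
  rw [Real.norm_of_nonneg (h.weight.nonneg x)]
  exact h.abs_nestedRisk_sub_infiniteRisk_le hT x

end TransientRule

end NestedRisk

/-! ### Lower semicontinuity of the risk in the rule and the state. -/

section Semicontinuity

/-- Fatou's lemma for weak* convergent measures. -/
theorem eventually_lt_integral_of_weakStar {X : Type*} [MeasurableSpace X] {p q : ℝ≥0∞}
    {P₀ : Measure X} [Fact (1 ≤ p)] (hpq : p.HolderConjugate q) [IsProbabilityMeasure P₀] {μs : ℕ → probDual P₀ q}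
    {μ : probDual P₀ q} (hμ : WeakStarTendsto p μs μ) {gs : ℕ → X → ℝ} {g G : X → ℝ}
    (hgs : ∀ k, Measurable (gs k)) (hg : Measurable g) (hG : MemLp G p P₀)
    (hgsG : ∀ k y, |gs k y| ≤ G y) (hgG : ∀ y, |g y| ≤ G y)
    (hlim : ∀ᵐ y ∂P₀, ∀ a < g y, ∀ᶠ k in atTop, a < gs k y) {a : ℝ}
    (ha : a < ∫ y, g y ∂(μ : Measure X)) :
    ∀ᶠ k in atTop, a < ∫ y, gs k y ∂(μs k : Measure X) := by
  -- Tail infima, capped by `g`: each `f n` is one fixed function, to which weak* convergence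
  -- applies, it lies below `gs k` for `k ≥ n`, and `f n → g` almost everywhere.
  set f : ℕ → X → ℝ := fun n y => ⨅ k, min (g y) (gs (n + k) y) with hf
  have hlow : ∀ n k y, -G y ≤ min (g y) (gs (n + k) y) := fun n k y =>
    le_min (abs_le.1 (hgG y)).1 (abs_le.1 (hgsG _ y)).1
  have hbdd : ∀ n y, BddBelow (Set.range fun k => min (g y) (gs (n + k) y)) := fun n y =>
    ⟨-G y, by rintro _ ⟨k, rfl⟩; exact hlow n k y⟩
  have hfm : ∀ n, Measurable (f n) := fun n => Measurable.iInf fun k => hg.min (hgs _)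
  have hfg : ∀ n y, f n y ≤ g y := fun n y => (ciInf_le (hbdd n y) 0).trans (min_le_left _ _)
  have hfgs : ∀ n k, n ≤ k → ∀ y, f n y ≤ gs k y := fun n k hnk y => by
    obtain ⟨j, rfl⟩ := Nat.exists_eq_add_of_le hnk
    exact (ciInf_le (hbdd n y) j).trans (min_le_right _ _)
  have hfG : ∀ n y, |f n y| ≤ G y := fun n y =>
    abs_le.2 ⟨le_ciInf fun k => hlow n k y, (hfg n y).trans (abs_le.1 (hgG y)).2⟩
  have hfL : ∀ n, MemLp (f n) p P₀ := fun n =>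
    hG.mono' (hfm n).aestronglyMeasurable (Eventually.of_forall (hfG n))
  have hft : ∀ᵐ y ∂P₀, Tendsto (fun n => f n y) atTop (𝓝 (g y)) := by
    filter_upwards [hlim] with y hy
    refine tendsto_order.2 ⟨fun b hb => ?_, fun b hb =>
      Eventually.of_forall fun n => (hfg n y).trans_lt hb⟩
    obtain ⟨b', hb, hb'⟩ := exists_between hb
    obtain ⟨n₀, hn₀⟩ := eventually_atTop.1 (hy b' hb')
    filter_upwards [eventually_ge_atTop n₀] with n hn
    exact hb.trans_le (le_ciInf fun k => le_min hb'.le (hn₀ _ (hn.trans (Nat.le_add_right n k))).le)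
  have hfi : Tendsto (fun n => ∫ y, f n y ∂(μ : Measure X)) atTop
      (𝓝 (∫ y, g y ∂(μ : Measure X))) :=
    tendsto_integral_of_dominated_convergence G (fun n => (hfm n).aestronglyMeasurable)
      (integrable_of_mem_probDual hpq μ.2 hG) (fun n => Eventually.of_forall (hfG n))
      (μ.2.2.1.ae_le hft)
  obtain ⟨n, hn⟩ := (hfi.eventually_const_lt ha).exists
  filter_upwards [(hμ (f n) (hfL n)).eventually_const_lt hn, eventually_ge_atTop n] with k hk hnk
  refine hk.trans_le (integral_mono (integrable_of_mem_probDual hpq (μs k).2 (hfL n))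
    (integrable_of_mem_probDual hpq (μs k).2 ?_) (hfgs n k hnk))
  exact hG.mono' (hgs k).aestronglyMeasurable (Eventually.of_forall (hgsG k))

variable {X 𝒰 : Type*} [TopologicalSpace X] [MeasurableSpace X] [TopologicalSpace 𝒰]
  [MeasurableSpace 𝒰] {p q : ℝ≥0∞} [Fact (1 ≤ p)] {P₀ : Measure X} [IsProbabilityMeasure P₀]
  {S : Model X 𝒰} {hQ : S.InDual P₀ q} {σ : RiskTransitionMapping p q P₀} {w : X → ℝ}
  {C : ℝ} {K : ℝ≥0} {π : Rule S} {πs : ℕ → Rule S} {x : X} {xs : ℕ → X}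

theorem RiskMDP.PairTendsto.tendsto_pt (h : PairTendsto P₀ πs xs π x) :
    Tendsto (fun k => (πs k).pt (xs k)) atTop (𝓝 (π.pt x)) :=
  tendsto_subtype_rng.2 (h.state.prodMk_nhds h.control)

theorem RiskMDP.PairTendsto.weakStarTendsto (h : PairTendsto P₀ πs xs π x)
    (hc : S.WeakStarContinuous p P₀) :
    WeakStarTendsto p (fun k => transition hQ (πs k) (xs k)) (transition hQ π x) :=
  fun v hv => ((hc v hv).tendsto _).comp h.tendsto_pt

variable [MeasurableSpace.CountablyGenerated X] [MeasurableSingletonClass X]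

/-- The risk at the limit is attained by some `μ`, while at the perturbed points any subgradient
gives a lower bound. It therefore suffices to approximate `μ` by subgradients and to apply the Fatou
lemma to the integrands. -/
theorem eventually_lt_nestedRisk (h : ∀ π, TransientRule hQ σ w C K π) (hG2 : σ.SubdiffLSC)
    (hlsc : ∀ y, LowerSemicontinuous fun z : S.Graph => S.c z.1.1 z.1.2 y)
    (hc : S.WeakStarContinuous p P₀) (T : ℕ) (π : Rule S) (πs : ℕ → Rule S) (x : X) (xs : ℕ → X)
    (hx : PairTendsto P₀ πs xs π x) {b : ℝ} (hb : ∀ k, w (xs k) ≤ b) {a : ℝ}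
    (ha : a < nestedRisk S hQ σ π T x) :
    ∀ᶠ k in atTop, a < nestedRisk S hQ σ (πs k) T (xs k) := by
  induction T generalizing x xs b a with
  | zero => exact Eventually.of_forall fun _ => ha
  | succ T ih =>
    have hJ := fun π => (h π).admissible_nestedRisk T
    have hcm := fun π => (h π).measurable_cost_add (hJ π).measurable
    have hsucc : ∀ π x, nestedRisk S hQ σ π (T + 1) x =
        σ.toFun ((h π).memLp_cost_add (hJ π) x).toLp x (transition hQ π x) :=
      fun π x => (h π).riskStep_eq (hJ π) x
    obtain ⟨M, hM⟩ := exists_kernel_subdiff (h π).p_ne_top (h π).conj hQ σ π (hcm π)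
      ((h π).memLp_cost_add (hJ π))
    obtain ⟨μ, hμ, he, hi⟩ := hM x
    obtain ⟨μs, hμs, hlim⟩ := hG2 x _ xs _ hx.state (hx.weakStarTendsto (hQ := hQ) hc) μ hμ
    rw [hsucc, ← hi, ← he] at ha
    have hbound : ∀ π' x' y, w x' ≤ max b (w x) →
        |S.c x' (π'.toFun x') y + nestedRisk S hQ σ π' T y| ≤
          C * max b (w x) + (C + TransientRule.riskConst S w C K) * w y := fun π' x' y hx' => by
      have h1 := (h π').abs_cost_add_le (v := nestedRisk S hQ σ π' T) x' y
      have h2 := (h π').abs_nestedRisk_le T y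
      have h3 := mul_le_mul_of_nonneg_left hx' (h π').C_nonneg
      linarith
    have hev := eventually_lt_integral_of_weakStar (h π).conj hlim
      (gs := fun k y => S.c (xs k) ((πs k).toFun (xs k)) y + nestedRisk S hQ σ (πs k) T y)
      (G := fun y => C * max b (w x) + (C + TransientRule.riskConst S w C K) * w y)
      (fun k => (hcm (πs k)).comp measurable_prodMk_left) ((hcm π).comp measurable_prodMk_left)
      ((memLp_const (C * max b (w x))).add
        ((h π).weight.memLp.const_mul (C + TransientRule.riskConst S w C K)))
      (fun k y => hbound (πs k) (xs k) y ((hb k).trans (le_max_left _ _)))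
      (fun y => hbound π x y (le_max_right _ _)) ?_ ha
    · filter_upwards [hev] with k hk
      rw [hsucc]
      exact hk.trans_le (integral_le_of_mem_subdiff (hμs k) _)
    · filter_upwards [hx.rule] with y hy d hd
      change d < S.c x (π.toFun x) y + nestedRisk S hQ σ π T y at hd
      -- The induction hypothesis is used at a fixed next state `y` with a constant state sequence;
      -- this is where convergence of the rules almost everywhere enters, and `w y` itself is the
      -- required bound.
      have hyp : PairTendsto P₀ πs (fun _ => y) π y := ⟨tendsto_const_nhds, hy, hx.rule⟩
      set δ := (S.c x (π.toFun x) y + nestedRisk S hQ σ π T y - d) / 2 with hδ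
      have hδ0 : 0 < δ := by linarith
      have h1 := hx.tendsto_pt.eventually (hlsc y (π.pt x) (S.c x (π.toFun x) y - δ)
        (sub_lt_self _ hδ0))
      have h2 := ih y (fun _ => y) hyp (fun _ => le_rfl)
        (sub_lt_self (nestedRisk S hQ σ π T y) hδ0)
      filter_upwards [h1, h2] with k hk1 hk2
      simp only [Rule.pt] at hk1
      linarith

theorem eventually_lt_infiniteRisk (h : ∀ π, TransientRule hQ σ w C K π) (hG2 : σ.SubdiffLSC)
    (hlsc : ∀ y, LowerSemicontinuous fun z : S.Graph => S.c z.1.1 z.1.2 y)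
    (hc : S.WeakStarContinuous p P₀) (hx : PairTendsto P₀ πs xs π x)
    (hw : (𝓝 x).IsBoundedUnder (· ≤ ·) w) {a : ℝ} (ha : a < infiniteRisk S hQ σ π x) :
    ∀ᶠ k in atTop, a < infiniteRisk S hQ σ (πs k) (xs k) := by
  obtain ⟨b, hb⟩ := hw
  rw [eventually_map] at hb
  obtain ⟨n, hn⟩ := eventually_atTop.1 (hx.state.eventually hb)
  set δ := (infiniteRisk S hQ σ π x - a) / 2 with hδ
  have hδ0 : 0 < δ := by linarith
  obtain ⟨T, hT0, hT⟩ : ∃ T : ℕ, 0 < T ∧ TransientRule.rateConst S w C K / T * b < δ := by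
    have h1 : Tendsto (fun T : ℕ => TransientRule.rateConst S w C K / T * b) atTop (𝓝 (0 * b)) :=
      (tendsto_const_div_atTop_nhds_zero_nat _).mul_const b
    rw [zero_mul] at h1
    exact ((eventually_gt_atTop 0).and (h1.eventually_lt_const hδ0)).exists
  have hclose : ∀ π' x', w x' ≤ b →
      |nestedRisk S hQ σ π' T x' - infiniteRisk S hQ σ π' x'| < δ := fun π' x' hx' =>
    (((h π').abs_nestedRisk_sub_infiniteRisk_le hT0 x').trans (mul_le_mul_of_nonneg_left hx'
      (div_nonneg (h π').rateConst_nonneg T.cast_nonneg))).trans_lt hT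
  -- Initial terms are dropped so that `w (xs k) ≤ b` holds for every remaining index. The two
  -- approximations of `J_∞` by `J_T` then cost `δ` each, and `2δ` is the gap to `a`.
  have hx' : PairTendsto P₀ (fun k => πs (k + n)) (fun k => xs (k + n)) π x :=
    ⟨hx.state.comp (tendsto_add_atTop_nat n), hx.control.comp (tendsto_add_atTop_nat n),
      hx.rule.mono fun y hy => hy.comp (tendsto_add_atTop_nat n)⟩
  have h1 := abs_lt.1 (hclose π x hb.self_of_nhds)
  have h2 := eventually_lt_nestedRisk h hG2 hlsc hc T π _ x _ hx'
    (fun k => hn _ (Nat.le_add_left n k)) (a := infiniteRisk S hQ σ π x - δ) (by linarith)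
  rw [← map_add_atTop_eq_nat n, eventually_map]
  filter_upwards [h2] with k hk
  have h3 := abs_lt.1 (hclose (πs (k + n)) (xs (k + n)) (hn _ (Nat.le_add_left n k)))
  linarith

end Semicontinuity

theorem theoremt {X 𝒰 : Type*}
    [TopologicalSpace X] [TopologicalSpace.MetrizableSpace X] [SecondCountableTopology X]
    [MeasurableSpace X] [BorelSpace X] [StandardBorelSpace X]
    [TopologicalSpace 𝒰] [TopologicalSpace.MetrizableSpace 𝒰] [SecondCountableTopology 𝒰]
    [MeasurableSpace 𝒰] [BorelSpace 𝒰] [StandardBorelSpace 𝒰]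
    (p q : ℝ≥0∞) [Fact (1 ≤ p)] (hp : p ≠ ∞) (hpq : p.HolderConjugate q)
    (P₀ : Measure X) [IsProbabilityMeasure P₀]
    (S : Model X 𝒰) (σ : RiskTransitionMapping p q P₀) (hσ : σ.LawInvariant)
    (w : X → ℝ) (hw : IsWeight w p P₀)
    (hG0 : S.InDual P₀ q) (hG1 : S.SetwiseContinuous) (hG2 : σ.SubdiffLSC)
    (hG3 : S.CostRegular w) :
    -- a risk-transient stationary policy
    (∀ π : Rule S, RiskTransient S hG0 σ w π →
      (∀ T, Measurable (nestedRisk S hG0 σ π T) ∧ MemLp (nestedRisk S hG0 σ π T) p P₀) ∧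
      (∀ T x, MemLp (fun y => S.c x (π.toFun x) y + nestedRisk S hG0 σ π T y) p P₀) ∧
      Measurable (infiniteRisk S hG0 σ π) ∧
      MemLp (infiniteRisk S hG0 σ π) p P₀ ∧
      Tendsto (fun T => eLpNorm (nestedRisk S hG0 σ π T - infiniteRisk S hG0 σ π) p P₀)
        atTop (𝓝 0) ∧
      (∀ x, Tendsto (fun T => nestedRisk S hG0 σ π T x) atTop
        (𝓝 (infiniteRisk S hG0 σ π x))) ∧
      infiniteRisk S hG0 σ π S.xA = 0 ∧
      wNorm (fun x : S.Eff => w x) (fun x : S.Eff => infiniteRisk S hG0 σ π x) < ∞ ∧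
      Tendsto (fun T => wNorm (fun x : S.Eff => w x)
        (fun x : S.Eff => nestedRisk S hG0 σ π T x - infiniteRisk S hG0 σ π x))
        atTop (𝓝 0)) ∧
    -- a uniformly risk-transient model
    (UniformlyRiskTransient S hG0 σ w →
      (∃ B : ℝ≥0, ∀ π : Rule S,
        wNorm (fun x : S.Eff => w x) (fun x : S.Eff => infiniteRisk S hG0 σ π x) ≤ B) ∧
      (S.WeakStarContinuous p P₀ →
        ∀ (π : Rule S) (x : X), (𝓝 x).IsBoundedUnder (· ≤ ·) w →
          ∀ (πs : ℕ → Rule S) (xs : ℕ → X), PairTendsto P₀ πs xs π x →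
            ∀ a < infiniteRisk S hG0 σ π x,
              ∀ᶠ k in atTop, a < infiniteRisk S hG0 σ (πs k) (xs k))) := by
  obtain ⟨C, hC, hcb⟩ := hG3.bounded
  have hrule : ∀ (K : ℝ≥0) (π : Rule S), TransienceEstimate S hG0 σ w π K →
      TransientRule hG0 σ w C K π := fun K π hK =>
    ⟨hp, hpq, hσ, hw, hG3.measurable, hC.le, hcb, hK⟩
  refine ⟨fun π ⟨K, hK⟩ => ?_, fun ⟨K, hK⟩ => ⟨?_, ?_⟩⟩
  · have h := hrule K π hK
    exact ⟨fun T => ⟨(h.admissible_nestedRisk T).measurable,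
        h.memLp_of_admissible (h.admissible_nestedRisk T)⟩,
      fun T x => h.memLp_cost_add (h.admissible_nestedRisk T) x,
      h.admissible_infiniteRisk.measurable, h.memLp_of_admissible h.admissible_infiniteRisk,
      h.tendsto_eLpNorm, h.tendsto_nestedRisk, h.infiniteRisk_absorbing,
      (h.wNorm_le_of_abs_le h.abs_infiniteRisk_le).trans_lt ENNReal.ofReal_lt_top,
      h.tendsto_wNorm⟩
  -- The constant involves the rule only through `K`, which is now common to all rules.
  · exact ⟨(TransientRule.riskConst S w C K).toNNReal, fun π =>
      (hrule K π (hK π)).wNorm_le_of_abs_le (hrule K π (hK π)).abs_infiniteRisk_le⟩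
  · exact fun hc π x hwx πs xs hx a ha =>
      eventually_lt_infiniteRisk (fun π => hrule K π (hK π)) hG2 hG3.lsc hc hx hwx ha
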